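/- Let $(\Omega,\mathcal F,\mathbb P)$ be a $\sigma$-finite measure space with a measurable flow $(\theta_s)_{s\in\mathbb R}$ (that is, $(\omega,s)\mapsto\theta_s\omega$ is measurable, $\theta_0=\mathrm{id}$, $\theta_s\circ\theta_t=\theta_{s+t}$). Assume that $\mathbb P$ is stationary, $\mathbb P(\theta_sA)=\mathbb P(A)$ for all $s\in\mathbb R$ and $A\in\mathcal F$, and ergodic: if $A\in\mathcal F$ and $\theta_sA=A$ for all $s$, then $\mathbb P(A)=0$ or $\mathbb P(A^c)=0$. Let $\xi,\eta$ be random measures on $\mathbb R$, that is, kernels from $\Omega$ to $\mathbb R$ which for $\mathbb P$-a.e. $\omega$ are finite on all compact sets. Assume that they are invariant: for $\mathbb P$-a.e. $\omega$, $\xi(\theta_t\omega,C-t)=\xi(\omega,C)$ for all $t\in\mathbb R$ and Borel $C\subset\mathbb R$, and likewise for $\eta$. Assume that $\xi(\omega)$ and $\eta(\omega)$ are mutually singular for $\mathbb P$-a.e. $\omega$, and that the intensities are finite and equal, $\mathbb E\,\xi[0,1]=\mathbb E\,\eta[0,1]<\infty$. Assume finally that $\xi(\omega,\mathbb R)\in\{0,\infty\}$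 for $\mathbb P$-a.e. $\omega$ (this is automatic if $\mathbb P$ is finite, or if the flow is conservative). The Palm measure of $\xi$ is $$\mathbb P_\xi(A):=\mathbb E\int \mathbf 1_{[0,1]}(s)\,\mathbf 1_A(\theta_s)\,\xi(ds),\qquad A\in\mathcal F,$$ and $\mathbb P_\eta$ is defined likewise. For $u\in[0,1]$ and $s\in\mathbb R$ let $$\tau^u(\omega,s):=\inf\{t>s:\ u\,\xi(\omega,\{s\})+\xi(\omega,(s,t))\le\eta(\omega,[s,t])\},\qquad \inf\emptyset:=\infty,$$ and $T^u(\omega):=\tau^u(\omega,0)$. Then $T^u<\infty$ holds $\mathbb P_\xi$-a.e. for Lebesgue-a.e. $u\in[0,1]$, and $$\int_0^1\mathbb P_\xi(\theta_{T^u}\in A)\,du=\mathbb P_\eta(A),\qquad A\in\mathcal F,$$ where $\theta_{T^u}(\omega):=\theta_{T^u(\omega)}\omega$ if $T^u(\omega)<\infty$, and the event $\{\theta_{T^u}\in A\}$ is understood as $\{T^u<\infty,\ \theta_{T^u}\in A\}$. If, moreover, $\xi$ is diffuse (for $\mathbb P$-a.e. $\omega$, $\xi(\omega,\{s\})=0$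 for all $s\in\mathbb R$), then, with $$\tau(\omega,s):=\inf\{t>s:\ \xi(\omega,[s,t])\le\eta(\omega,[s,t])\},\qquad T(\omega):=\tau(\omega,0),$$ we have $T<\infty$ $\mathbb P_\xi$-a.e. and $$\mathbb P_\xi(\theta_T\in A)=\mathbb P_\eta(A),\qquad A\in\mathcal F,$$ with the same convention for $\theta_T$. -/

import Mathlib

open MeasureTheory ProbabilityTheory Set
open scoped ENNReal

noncomputable section

/-- A measurable flow `θ` on `Ω`, indexed by `ℝ`. -/
structure IsMeasurableFlow {Ω : Type*} [MeasurableSpace Ω] (θ : ℝ → Ω → Ω) : Prop where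
  measurable : Measurable fun p : Ω × ℝ => θ p.2 p.1
  zero : ∀ ω, θ 0 ω = ω
  add : ∀ s t ω, θ s (θ t ω) = θ (s + t) ω

/-- `P` is stationary under `θ`: the images `θ s A` have the same measure as `A`. -/
def IsStationaryMeasure {Ω : Type*} [MeasurableSpace Ω] (θ : ℝ → Ω → Ω) (P : Measure Ω) : Prop :=
  ∀ (s : ℝ) (A : Set Ω), MeasurableSet A → P (θ s '' A) = P A

/-- `P` is ergodic under `θ`: the strictly invariant events are null or co-null. -/
def IsErgodicFlow {Ω : Type*} [MeasurableSpace Ω] (θ : ℝ → Ω → Ω) (P : Measure Ω) : Prop :=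
  ∀ A : Set Ω, MeasurableSet A → (∀ s : ℝ, θ s '' A = A) → P A = 0 ∨ P Aᶜ = 0

/-- A kernel from `Ω` to `ℝ` is a random measure if it is `P`-a.e. finite on compact sets. -/
def IsRandomMeasure {Ω : Type*} [MeasurableSpace Ω] (P : Measure Ω) (ξ : Kernel Ω ℝ) : Prop :=
  ∀ᵐ ω ∂P, ∀ C : Set ℝ, IsCompact C → ξ ω C < ∞

/-- Invariance (flow-adaptedness) of a kernel: for `P`-a.e. `ω`, `ξ(θ_t ω, C - t) = ξ(ω, C)` for
all `t` and all Borel sets `C`. Here `{x | x + t ∈ C}` is `C - t`. -/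
def IsInvariantKernel {Ω : Type*} [MeasurableSpace Ω] (θ : ℝ → Ω → Ω) (P : Measure Ω)
    (ξ : Kernel Ω ℝ) : Prop :=
  ∀ᵐ ω ∂P, ∀ (t : ℝ) (C : Set ℝ), MeasurableSet C → ξ (θ t ω) {x | x + t ∈ C} = ξ ω C

/-- The intensity `λ_ξ = E ξ[0,1]`. -/
def intensity {Ω : Type*} [MeasurableSpace Ω] (P : Measure Ω) (ξ : Kernel Ω ℝ) : ℝ≥0∞ :=
  ∫⁻ ω, ξ ω (Icc 0 1) ∂P

/-- The Palm measure of `ξ`: the mixture over `ω` (under `P`) of the images of `ξ(ω, ·)`, restricted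
to `[0,1]`, under `s ↦ θ_s ω`. See `palmMeasure_apply` for the explicit formula. -/
def palmMeasure {Ω : Type*} [MeasurableSpace Ω] (θ : ℝ → Ω → Ω) (P : Measure Ω)
    (ξ : Kernel Ω ℝ) : Measure Ω :=
  P.bind fun ω => ((ξ ω).restrict (Icc 0 1)).map fun s => θ s ω

/-- `P_ξ(A) = E ∫ 1_{[0,1]}(s) 1_A(θ_s) ξ(ds)`. -/
theorem palmMeasure_apply {Ω : Type*} [MeasurableSpace Ω] {θ : ℝ → Ω → Ω} {P : Measure Ω}
    {ξ : Kernel Ω ℝ} (hθ : IsMeasurableFlow θ) (hξ : IsRandomMeasure P ξ)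
    {A : Set Ω} (hA : MeasurableSet A) :
    palmMeasure θ P ξ A = ∫⁻ ω, ∫⁻ s in Icc 0 1, A.indicator 1 (θ s ω) ∂(ξ ω) ∂P := by
  have hm : ∀ ω, Measurable fun s => θ s ω := fun ω =>
    hθ.measurable.comp (measurable_const.prodMk measurable_id)
  have hG : MeasurableSet {ω | ξ ω (Icc 0 1) < ∞} :=
    measurableSet_lt (ξ.measurable_coe measurableSet_Icc) measurable_const
  classical
  let κ : Kernel Ω ℝ := Kernel.piecewise hG (ξ.restrict (measurableSet_Icc (a := (0 : ℝ)) (b := 1))) 0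
  have hκ : ∀ ω, IsFiniteMeasure (κ ω) := by
    intro ω
    refine ⟨?_⟩
    by_cases h : ξ ω (Icc 0 1) < ∞
    · simp [κ, Kernel.piecewise_apply, h, Kernel.restrict_apply]
    · simp [κ, Kernel.piecewise_apply, h]
  have hae : AEMeasurable (fun ω => ((ξ ω).restrict (Icc 0 1)).map fun s => θ s ω) P := by
    refine ⟨fun ω => (κ ω).map fun s => θ s ω, ?_, ?_⟩
    · refine Measure.measurable_of_measurable_coe _ fun s hs => ?_
      simp_rw [Measure.map_apply (hm _) hs]
      exact Kernel.measurable_kernel_prodMk_left_of_finite (hθ.measurable hs) hκ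
    · filter_upwards [hξ] with ω hω
      have h := hω (Icc 0 1) isCompact_Icc
      simp [κ, Kernel.piecewise_apply, h, Kernel.restrict_apply]
  rw [palmMeasure, Measure.bind_apply hA hae]
  refine lintegral_congr fun ω => ?_
  rw [Measure.map_apply (hm ω) hA, ← lintegral_indicator_one (hm ω hA)]
  rfl

/-- `τ^u(ω, s) = inf {t > s : u ξ{s} + ξ(s,t) ≤ η[s,t]}`, with `inf ∅ = ∞` (`⊤` in `EReal`). -/
def allocU {Ω : Type*} [MeasurableSpace Ω] (ξ η : Kernel Ω ℝ) (u : ℝ) (ω : Ω) (s : ℝ) : EReal :=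
  sInf ((fun t : ℝ => (t : EReal)) ''
    {t : ℝ | s < t ∧ ENNReal.ofReal u * ξ ω {s} + ξ ω (Ioo s t) ≤ η ω (Icc s t)})

/-- `τ(ω, s) = inf {t > s : ξ[s,t] ≤ η[s,t]}`, with `inf ∅ = ∞`. -/
def alloc {Ω : Type*} [MeasurableSpace Ω] (ξ η : Kernel Ω ℝ) (ω : Ω) (s : ℝ) : EReal :=
  sInf ((fun t : ℝ => (t : EReal)) '' {t : ℝ | s < t ∧ ξ ω (Icc s t) ≤ η ω (Icc s t)})

/-- The event `θ_T ∈ A` for a `[-∞,∞]`-valued time `T`; `θ_T` is defined only where `T` is finite. -/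
def shiftEvent {Ω : Type*} (θ : ℝ → Ω → Ω) (T : Ω → EReal) (A : Set Ω) : Set Ω :=
  {ω | ∃ t : ℝ, T ω = (t : EReal) ∧ θ t ω ∈ A}

end

/-! The allocation is a greedy matching. The pairs `(s, u)`, distributed as `ξ(ω) ⊗ unif`, are units
of mass, and each travels right to the first place where `η` has absorbed it together with all
`ξ`-mass behind it. The proof first bounds the transported measure pathwise by `η`, and then uses
stationarity, equal intensities and ergodicity to remove the slack.

Pathwise, let `μ`, `ν` be locally finite and singular, and give `(s, u)` the time `κ(-∞, s] - u
κ{s}` with `κ = μ + ν` (after restriction to a bounded window). Exactly the portion `u μ{s}` of an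
atom of `μ` then lies after `(s, u)`, as in the definition of the hitting time. In this time the
path `μ - ν` becomes a Lipschitz function `g` with slopes `±1`, by singularity. A unit of `μ` is
unabsorbed at the end of the window precisely when `g` does not come back to its level. The total
length of such times is the final height of `g` above its minimum, because they carry the derivative
of the future infimum (`volume_noReturn`, `prod_noReturn_of_finite`). Comparing two windows, the
mass sent from `(c, ∞)` into `(a, b]` is `ν(a, b]` minus the drop of the running minimum between `a`
and `b` (`prod_hit_mem_Ioc`). Hence `hitMeasure μ ν ≤ ν`, with equality if arbitrarily far to the
left there are points after which the path never goes below its left limit; unabsorbed units of `μ`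
supply such points.

The mass transport principle identifies the shifted Palm measure of `ξ`, averaged over `u`, with the
Palm measure of the transported measure (`lintegral_palm_shiftEvent`), so it is at most `P_η`. By
ergodicity there are two cases. If almost surely nothing stays unmatched, the shifted measure has
the total mass of `P_η`, and domination with equal finite mass is equality. If almost surely
something stays unmatched, a second mass transport shows that the unmatched part has no first block:
otherwise all of `ξ`, of infinite mass, could be sent to that block although each block sends out
only finite mean mass (`ae_unmatched_Iio`). Thus unmatched points lie arbitrarily far to the left,
the transported measure is `η`, and comparing total masses shows that the lost mass vanishes.

The exceptional sets are removed beforehand by setting both kernels to zero off an invariant set of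
full measure (`exists_isCovariantPair`). -/

/-! ### Paths with slopes `±1` and their future infimum. -/

open Filter Topology in
/-- Let `g` be a 1-Lipschitz function with slopes `±1`. The points of `(0, L]` where `g` increases
and to whose level `g` does not return before `L` have total length `g L - min g`. -/
theorem volume_noReturn {g f : ℝ → ℝ} (hg : LipschitzWith 1 g)
    (hd : ∀ᵐ x, HasDerivAt g (f x) x) (hf : ∀ x, f x = 1 ∨ f x = -1) {L : ℝ} (hL : 0 ≤ L) :
    NullMeasurableSet {x | x ∈ Ioc 0 L ∧ f x = 1 ∧ ∀ y ∈ Ioc x L, g x < g y} ∧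
    volume {x | x ∈ Ioc 0 L ∧ f x = 1 ∧ ∀ y ∈ Ioc x L, g x < g y} =
      ENNReal.ofReal (g L - sInf (g '' Icc 0 L)) := by
  set R := {x | x ∈ Ioc 0 L ∧ f x = 1 ∧ ∀ y ∈ Ioc x L, g x < g y} with hR
  -- The future infimum is nondecreasing and Lipschitz on `[0, L]`, and increases there by exactly
  -- `g L - min g`. It remains to see that its derivative is almost everywhere the indicator of `R`.
  let I : ℝ → ℝ := fun x => sInf (g '' Icc x L)
  have hmin : ∀ x ≤ L, ∃ y ∈ Icc x L, I x = g y ∧ ∀ z ∈ Icc x L, g y ≤ g z := by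
    intro x hx
    obtain ⟨y, hy, hy'⟩ := isCompact_Icc.exists_isMinOn (nonempty_Icc.2 hx)
      (hg.continuous.continuousOn (s := Icc x L))
    refine ⟨y, hy, IsLeast.csInf_eq ⟨⟨y, hy, rfl⟩, ?_⟩, fun z hz => hy' hz⟩
    rintro _ ⟨z, hz, rfl⟩
    exact hy' hz
  have hle : ∀ x ≤ L, ∀ z ∈ Icc x L, I x ≤ g z := by
    intro x hx z hz
    obtain ⟨y, -, h1, h2⟩ := hmin x hx
    rw [h1]; exact h2 z hz
  have hmono : ∀ x x', x ≤ x' → x' ≤ L → I x ≤ I x' := by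
    intro x x' h h'
    obtain ⟨y, hy, h1, -⟩ := hmin x' h'
    rw [h1]; exact hle x (h.trans h') y ⟨h.trans hy.1, hy.2⟩
  have hlip : ∀ x y, |g x - g y| ≤ |x - y| := by
    intro x y
    have := hg.dist_le_mul x y
    simpa [Real.dist_eq] using this
  have hIlip : LipschitzOnWith 1 I (uIcc 0 L) := by
    have key : ∀ x x', x ≤ x' → x' ≤ L → I x' ≤ I x + (x' - x) := by
      intro x x' h h'
      obtain ⟨y, hy, h1, -⟩ := hmin x (h.trans h')
      rcases le_total x' y with h3 | h3
      · have := hle x' h' y ⟨h3, hy.2⟩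
        linarith
      · have h4 := hle x' h' x' ⟨le_rfl, h'⟩
        have h5 := (abs_le.1 (hlip x' y)).2
        rw [abs_of_nonneg (by linarith)] at h5
        linarith [hy.1]
    rw [uIcc_of_le hL]
    refine LipschitzOnWith.of_dist_le_mul fun x hx y hy => ?_
    simp only [NNReal.coe_one, one_mul, Real.dist_eq]
    rcases le_total x y with h | h
    · rw [abs_sub_comm, abs_sub_comm x, abs_of_nonneg (by linarith [hmono x y h hy.2]),
        abs_of_nonneg (by linarith)]
      linarith [key x y h hy.2]
    · rw [abs_of_nonneg (by linarith [hmono y x h hx.2]), abs_of_nonneg (by linarith)]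
      linarith [key y x h hx.2]
  have hac := hIlip.absolutelyContinuousOnInterval
  have hint := hac.integral_deriv_eq_sub
  have hIL : I L = g L := by simp [I]
  -- pointwise identification of the derivative of the future infimum
  have hpt : ∀ᵐ x, x ∈ Ioo 0 L → (x ∈ R → deriv I x = 1) ∧ (x ∉ R → deriv I x = 0) := by
    filter_upwards [hd, hac.ae_differentiableAt] with x hgx hIx hx
    have hIx := (hIx (by rw [uIcc_of_le hL]; exact ⟨hx.1.le, hx.2.le⟩)).hasDerivAt
    by_cases hstrict : ∀ y ∈ Ioc x L, g x < g y
    · have hIgx : I x = g x := by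
        obtain ⟨y, hy, h1, h2⟩ := hmin x hx.2.le
        rcases hy.1.eq_or_lt with h | h
        · rw [h1, h]
        · have := hstrict y ⟨h, hy.2⟩
          have := h2 x ⟨le_rfl, hx.2.le⟩
          linarith
      -- `g - I` is nonnegative near `x` and vanishes at `x`, so both derivatives agree;
      -- monotonicity of `I` then excludes slope `-1`.
      have hloc : IsLocalMin (fun z => g z - I z) x := by
        filter_upwards [Iio_mem_nhds hx.2] with z hz
        have := hle z hz.le z ⟨le_rfl, hz.le⟩
        linarith
      have h0 := hloc.hasDerivAt_eq_zero (hgx.sub hIx)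
      have hnn : 0 ≤ deriv I x := by
        have ht := hIx.tendsto_slope.mono_left (nhdsGT_le_nhdsNE x)
        refine ge_of_tendsto ht ?_
        filter_upwards [Ioo_mem_nhdsGT hx.2] with z hz
        rw [slope_def_field]
        have := hmono x z hz.1.le hz.2.le
        have := hz.1
        apply div_nonneg <;> linarith
      have hf1 : f x = 1 := by
        rcases hf x with h | h
        · exact h
        · rw [h] at h0; linarith
      refine ⟨fun _ => by linarith, fun hn => (hn ⟨⟨hx.1, hx.2.le⟩, hf1, hstrict⟩).elim⟩
    · refine ⟨fun h => (hstrict h.2.2).elim, fun _ => ?_⟩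
      push Not at hstrict
      obtain ⟨y, hy, hyx⟩ := hstrict
      -- A minimum attained strictly to the right of `x` keeps `I` constant on `[x, z]`, so the
      -- right slopes at `x` vanish.
      have : ∃ z ∈ Ioc x L, I x = g z := by
        obtain ⟨z, hz, h1, h2⟩ := hmin x hx.2.le
        rcases hz.1.eq_or_lt with h | h
        · refine ⟨y, hy, le_antisymm ?_ ?_⟩
          · exact hle x hx.2.le y ⟨hy.1.le, hy.2⟩
          · rw [h1, ← h]; exact hyx
        · exact ⟨z, ⟨h, hz.2⟩, h1⟩
      obtain ⟨z, hz, hIz⟩ := this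
      have ht := hIx.tendsto_slope.mono_left (nhdsGT_le_nhdsNE x)
      refine tendsto_nhds_unique ht (tendsto_const_nhds.congr' ?_)
      filter_upwards [Ioo_mem_nhdsGT hz.1] with w hw
      have h1 := hmono x w hw.1.le (hw.2.le.trans hz.2)
      have h2 := hle w (hw.2.le.trans hz.2) z ⟨hw.2.le, hz.2⟩
      have : I w = I x := by linarith
      simp [slope_def_field, this]
  let S : Set ℝ := {x | deriv I x = 1} ∩ Ioo 0 L
  have hS : MeasurableSet S :=
    ((measurable_deriv I) (measurableSet_singleton 1)).inter measurableSet_Ioo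
  have hRS : R =ᵐ[volume] S := by
    have hne : ∀ᵐ x : ℝ, x ≠ L := by simp [ae_iff, measure_singleton]
    filter_upwards [hpt, hne] with x hx hxL
    apply propext
    constructor
    · intro h
      have hx' : x ∈ Ioo 0 L := ⟨h.1.1, lt_of_le_of_ne h.1.2 hxL⟩
      exact ⟨(hx hx').1 h, hx'⟩
    · rintro ⟨h1, h2⟩
      by_contra h
      have := (hx h2).2 h
      have h1 : deriv I x = 1 := h1
      linarith
  refine ⟨hS.nullMeasurableSet.congr hRS.symm, ?_⟩
  rw [measure_congr hRS]
  have hSfin : volume S ≠ ∞ :=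
    ((measure_mono inter_subset_right).trans_lt (by simp : volume (Ioo 0 L) < ∞)).ne
  have : ∫ x in (0)..L, deriv I x = (volume S).toReal := by
    rw [intervalIntegral.integral_of_le hL, integral_Ioc_eq_integral_Ioo]
    have h1 : ∫ x in Ioo 0 L, deriv I x = ∫ x in Ioo 0 L, S.indicator 1 x := by
      refine setIntegral_congr_ae measurableSet_Ioo ?_
      filter_upwards [hpt] with x hx hxm
      by_cases h : x ∈ R
      · rw [(hx hxm).1 h, indicator_of_mem (show x ∈ S from ⟨(hx hxm).1 h, hxm⟩)]; rfl
      · rw [(hx hxm).2 h, indicator_of_notMem]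
        rintro ⟨h1, -⟩
        have h1 : deriv I x = 1 := h1
        linarith [(hx hxm).2 h]
    rw [h1, integral_indicator_one hS, measureReal_restrict_apply hS,
      inter_eq_self_of_subset_left inter_subset_right, measureReal_def]
  rw [hint, hIL] at this
  rw [show g L - sInf (g '' Icc 0 L) = g L - I 0 from rfl, this, ENNReal.ofReal_toReal hSfin]

/-! ### The time change that spreads out atoms. -/

/-- The uniform distribution on `[0, 1]`. -/
noncomputable abbrev unif : Measure ℝ := volume.restrict (Icc (0 : ℝ) 1)

instance : IsProbabilityMeasure unif := ⟨by simp [unif]⟩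

theorem ae_unif_mem : ∀ᵐ u ∂unif, u ∈ Ioo (0 : ℝ) 1 := by
  have : ∀ᵐ u : ℝ, u ≠ 0 ∧ u ≠ 1 := by
    have h0 : ∀ᵐ x : ℝ, x ≠ 0 := by simp [ae_iff, measure_singleton]
    have h1 : ∀ᵐ x : ℝ, x ≠ 1 := by simp [ae_iff, measure_singleton]
    filter_upwards [h0, h1] with x h h' using ⟨h, h'⟩
  filter_upwards [ae_restrict_of_ae this, ae_restrict_mem measurableSet_Icc] with u hu hu'
  exact ⟨lt_of_le_of_ne hu'.1 hu.1.symm, lt_of_le_of_ne hu'.2 hu.2⟩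

/-- A measure does not charge the points to the right of which it has no mass. -/
theorem measure_setOf_measure_Ici_eq_zero (ρ : Measure ℝ) : ρ {s | ρ (Ici s) = 0} = 0 := by
  have hsub : {s | ρ (Ici s) = 0} ⊆ (⋃ q : {q : ℚ // ρ (Ici (q : ℝ)) = 0}, Ici ((q : ℚ) : ℝ)) ∪
      {s | ρ (Ici s) = 0 ∧ ∀ q : ℚ, (q : ℝ) ≤ s → ρ (Ici (q : ℝ)) ≠ 0} := by
    intro s hs
    by_cases h : ∃ q : ℚ, (q : ℝ) ≤ s ∧ ρ (Ici (q : ℝ)) = 0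
    · obtain ⟨q, h1, h2⟩ := h
      exact Or.inl (mem_iUnion.2 ⟨⟨q, h2⟩, h1⟩)
    · push Not at h
      exact Or.inr ⟨hs, h⟩
  refine measure_mono_null hsub (measure_union_null (measure_iUnion_null fun q => q.2) ?_)
  -- The null rays with rational endpoints miss at most one point: a rational between two missed
  -- points would begin a null ray containing the larger one.
  set Z := {s | ρ (Ici s) = 0 ∧ ∀ q : ℚ, (q : ℝ) ≤ s → ρ (Ici (q : ℝ)) ≠ 0}
  have hlt : ∀ s ∈ Z, ∀ s' ∈ Z, ¬ s < s' := by
    intro s hs s' hs' h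
    obtain ⟨q, h1, h2⟩ := exists_rat_btwn h
    exact hs'.2 q h2.le (measure_mono_null (Ici_subset_Ici.2 h1.le) hs.1)
  rcases Z.eq_empty_or_nonempty with h | ⟨s, hs⟩
  · rw [h]; simp
  · refine measure_mono_null (t := Ici s) (fun s' hs' => ?_) hs.1
    exact not_lt.1 (hlt s' hs' s hs)

theorem measure_setOf_measure_Iic_eq_zero (ρ : Measure ℝ) : ρ {s | ρ (Iic s) = 0} = 0 := by
  have h := measure_setOf_measure_Ici_eq_zero (ρ.map (MeasurableEquiv.neg ℝ))
  simp only [MeasurableEquiv.map_apply] at h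
  convert h using 2
  ext s
  simp

/-- Apply the statement on null right rays to `κ` restricted to `Iio q`, for rational `q`. It
ensures that the new time strictly advances between a typical point and any later one. -/
theorem ae_measure_Ico_ne_zero (κ : Measure ℝ) : ∀ᵐ s ∂κ, ∀ t, s < t → κ (Ico s t) ≠ 0 := by
  have h : ∀ q : ℚ, ∀ᵐ s ∂κ, s < (q : ℝ) → κ (Ico s (q : ℝ)) ≠ 0 := by
    intro q
    have h := measure_setOf_measure_Ici_eq_zero (κ.restrict (Iio (q : ℝ)))
    rw [Measure.restrict_apply' measurableSet_Iio] at h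
    rw [ae_iff]
    refine measure_mono_null ?_ h
    intro s hs
    simp only [mem_ofPred_eq, Classical.not_imp, not_not] at hs
    refine ⟨?_, hs.1⟩
    simp only [mem_ofPred_eq]
    rw [Measure.restrict_apply measurableSet_Ici, Ici_inter_Iio]
    exact hs.2
  filter_upwards [ae_all_iff.2 h] with s hs t hst h0
  obtain ⟨q, h1, h2⟩ := exists_rat_btwn hst
  exact hs q h1 (measure_mono_null (Ico_subset_Ico_right h2.le) h0)

theorem ae_measure_Ioc_ne_zero (κ : Measure ℝ) : ∀ᵐ s ∂κ, ∀ t, t < s → κ (Ioc t s) ≠ 0 := by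
  have h : ∀ q : ℚ, ∀ᵐ s ∂κ, (q : ℝ) < s → κ (Ioc (q : ℝ) s) ≠ 0 := by
    intro q
    have h := measure_setOf_measure_Iic_eq_zero (κ.restrict (Ioi (q : ℝ)))
    rw [Measure.restrict_apply' measurableSet_Ioi] at h
    rw [ae_iff]
    refine measure_mono_null ?_ h
    intro s hs
    simp only [mem_ofPred_eq, Classical.not_imp, not_not] at hs
    refine ⟨?_, hs.1⟩
    simp only [mem_ofPred_eq]
    rw [Measure.restrict_apply measurableSet_Iic, inter_comm, Ioi_inter_Iic]
    exact hs.2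
  filter_upwards [ae_all_iff.2 h] with s hs t hst h0
  obtain ⟨q, h1, h2⟩ := exists_rat_btwn hst
  exact hs q h2 (measure_mono_null (Ioc_subset_Ioc_left h1.le) h0)

/-- The randomized distribution function of `κ`: atoms are spread out linearly. -/
noncomputable def timeChange (κ : Measure ℝ) (p : ℝ × ℝ) : ℝ :=
  κ.real (Iic p.1) - p.2 * κ.real {p.1}

/-- The set of points preceding `(s, u)` when the fibre over each `s` is traversed downwards. -/
def precSet (s u : ℝ) : Set (ℝ × ℝ) := Iio s ×ˢ Icc 0 1 ∪ {s} ×ˢ Icc u 1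

theorem timeChange_le_Iic {κ : Measure ℝ} {s u : ℝ} (hu : 0 ≤ u) : timeChange κ (s, u) ≤ κ.real (Iic s) := by
  have : 0 ≤ u * κ.real {s} := mul_nonneg hu measureReal_nonneg
  simp only [timeChange]; linarith

theorem prod_unif_inter {κ : Measure ℝ} [SFinite κ] (A : Set (ℝ × ℝ)) :
    (κ.prod unif) (A ∩ univ ×ˢ Icc 0 1) = (κ.prod unif) A := by
  refine measure_congr ?_
  have h : ∀ᵐ p ∂(κ.prod unif), p.2 ∈ Icc (0 : ℝ) 1 :=
    Measure.quasiMeasurePreserving_snd.ae (ae_restrict_mem measurableSet_Icc)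
  filter_upwards [h] with p hp
  apply propext
  exact ⟨fun h => h.1, fun h => ⟨h, trivial, hp⟩⟩

section
variable {κ : Measure ℝ} [IsFiniteMeasure κ]

theorem real_Iic_eq (s : ℝ) : κ.real (Iic s) = κ.real (Iio s) + κ.real {s} := by
  rw [← Iio_union_right, measureReal_union (by simp) (measurableSet_singleton s)]

theorem measurable_timeChange : Measurable (timeChange κ) := by
  have h1 : Measurable fun s => κ.real (Iic s) := by
    have : Monotone fun s => κ.real (Iic s) :=
      fun s t h => measureReal_mono (Iic_subset_Iic.2 h)
    exact this.measurable
  have h2 : Measurable fun s => κ.real (Iio s) := by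
    have : Monotone fun s => κ.real (Iio s) :=
      fun s t h => measureReal_mono (Iio_subset_Iio h)
    exact this.measurable
  have h3 : Measurable fun s => κ.real {s} := by
    have : (fun s => κ.real {s}) = fun s => κ.real (Iic s) - κ.real (Iio s) := by
      ext s; rw [real_Iic_eq]; ring
    rw [this]; exact h1.sub h2
  exact (h1.comp measurable_fst).sub (measurable_snd.mul (h3.comp measurable_fst))

theorem timeChange_eq (s u : ℝ) :
    timeChange κ (s, u) = κ.real (Iio s) + (1 - u) * κ.real {s} := by
  simp only [timeChange, real_Iic_eq]; ring

theorem timeChange_nonneg {s u : ℝ} (hu : u ≤ 1) : 0 ≤ timeChange κ (s, u) := by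
  rw [timeChange_eq]
  have : 0 ≤ (1 - u) * κ.real {s} := mul_nonneg (by linarith) measureReal_nonneg
  have : 0 ≤ κ.real (Iio s) := measureReal_nonneg
  linarith

theorem Iio_le_timeChange {s u : ℝ} (hu : u ≤ 1) : κ.real (Iio s) ≤ timeChange κ (s, u) := by
  have : 0 ≤ (1 - u) * κ.real {s} := mul_nonneg (by linarith) measureReal_nonneg
  rw [timeChange_eq]; linarith

theorem timeChange_le {s u : ℝ} (hu : 0 ≤ u) : timeChange κ (s, u) ≤ κ.real univ :=
  (timeChange_le_Iic hu).trans (measureReal_mono (subset_univ _))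

theorem prod_unif_precSet {s u : ℝ} (hu : u ∈ Icc (0 : ℝ) 1) :
    (κ.prod unif) (precSet s u) = ENNReal.ofReal (κ.real (Iio s) + (1 - u) * κ.real {s}) := by
  have hd : Disjoint (Iio s ×ˢ Icc (0 : ℝ) 1) ({s} ×ˢ Icc u 1) := by
    rw [Set.disjoint_left]
    rintro ⟨a, b⟩ ⟨h1, -⟩ ⟨h2, -⟩
    exact (ne_of_lt h1) h2
  rw [precSet, measure_union hd ((measurableSet_singleton s).prod measurableSet_Icc),
    Measure.prod_prod, Measure.prod_prod, Measure.restrict_apply measurableSet_Icc,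
    Measure.restrict_apply measurableSet_Icc, inter_self,
    inter_eq_self_of_subset_left (Icc_subset_Icc_left hu.1), Real.volume_Icc, Real.volume_Icc,
    ENNReal.ofReal_add measureReal_nonneg (mul_nonneg (by linarith [hu.2]) measureReal_nonneg),
    ENNReal.ofReal_mul (by linarith [hu.2]), ofReal_measureReal, ofReal_measureReal]
  simp [mul_comm]

theorem precSet_subset {s u : ℝ} :
    precSet s u ⊆ {p | timeChange κ p ≤ timeChange κ (s, u)} ∪ {_p | 1 < u} := by
  by_cases hu : 1 < u
  · intro p _; exact Or.inr hu
  rintro ⟨a, b⟩ (⟨h1, h2⟩ | ⟨h1, h2⟩)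
  · left
    exact (timeChange_le_Iic h2.1).trans ((measureReal_mono (Iic_subset_Iio.2 h1)).trans
      (Iio_le_timeChange (not_lt.1 hu)))
  · left
    obtain rfl : a = s := h1
    have : u * κ.real {a} ≤ b * κ.real {a} := mul_le_mul_of_nonneg_right h2.1 measureReal_nonneg
    simp only [mem_ofPred_eq, timeChange]
    linarith

open Filter Topology in
/-- Every level strictly between `0` and the total mass is attained by the time change. -/
theorem exists_timeChange_eq {x : ℝ} (hx : x ∈ Ioo 0 (κ.real univ)) :
    ∃ s, ∃ u ∈ Icc (0 : ℝ) 1, timeChange κ (s, u) = x ∧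
      {p | timeChange κ p ≤ x} ∩ univ ×ˢ Icc 0 1 = precSet s u := by
  have htop : Tendsto (fun s => κ.real (Iic s)) atTop (𝓝 (κ.real univ)) := by
    have := tendsto_measure_Iic_atTop κ
    exact (ENNReal.tendsto_toReal (measure_ne_top κ univ)).comp this
  have hbot : Tendsto (fun s => κ.real (Iic s)) atBot (𝓝 0) := by
    have h : Tendsto (fun s => κ (Iic s)) atBot (𝓝 (κ (⋂ s : ℝ, Iic s))) :=
      tendsto_measure_iInter_atBot (fun s => measurableSet_Iic.nullMeasurableSet)
        (fun s t h => Iic_subset_Iic.2 h) ⟨0, measure_ne_top _ _⟩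
    rw [iInter_Iic_eq_empty_iff.2 (by simp [not_bddBelow_univ]), measure_empty] at h
    have h' := (ENNReal.tendsto_toReal ENNReal.zero_ne_top).comp h
    rw [ENNReal.toReal_zero] at h'
    exact h'
  have hmono : Monotone fun s => κ.real (Iic s) := fun s t h => measureReal_mono (Iic_subset_Iic.2 h)
  -- The inequality is strict so that every `t` beyond the infimum already has more than `x` to its
  -- left; no later fibre then meets the sublevel set.
  set A := {s | x < κ.real (Iic s)} with hA
  have hne : A.Nonempty := ((htop.eventually (lt_mem_nhds hx.2)).exists)
  have hbdd : BddBelow A := by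
    obtain ⟨s, hs⟩ := (hbot.eventually (gt_mem_nhds hx.1)).exists
    refine ⟨s, fun t ht => ?_⟩
    by_contra h
    have h1 := hmono (not_le.1 h).le
    have h2 : x < κ.real (Iic t) := ht
    simp only at h1
    linarith
  set s := sInf A with hs
  have hlt : ∀ t < s, κ.real (Iic t) ≤ x := fun t ht => not_lt.1 (notMem_of_lt_csInf (s := A) ht hbdd)
  have hgt : ∀ t, s < t → x < κ.real (Iio t) := by
    intro t ht
    obtain ⟨r, hr, hrt⟩ := exists_lt_of_csInf_lt hne ht
    exact lt_of_lt_of_le hr (measureReal_mono (Iic_subset_Iio.2 hrt))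
  have h1 : κ.real (Iio s) ≤ x := by
    have h : Tendsto (fun n : ℕ => κ (Iic (s - 1 / (n + 1)))) atTop
        (𝓝 (κ (⋃ n : ℕ, Iic (s - 1 / ((n : ℝ) + 1))))) := by
      refine tendsto_measure_iUnion_atTop fun m n hmn => Iic_subset_Iic.2 ?_
      have : (1 : ℝ) / (n + 1) ≤ 1 / (m + 1) := by gcongr
      linarith
    have hU : (⋃ n : ℕ, Iic (s - 1 / ((n : ℝ) + 1))) = Iio s := by
      ext t
      simp only [mem_iUnion, mem_Iic, mem_Iio]
      constructor
      · rintro ⟨n, hn⟩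
        have : (0 : ℝ) < 1 / (n + 1) := by positivity
        linarith
      · intro h
        obtain ⟨n, hn⟩ := exists_nat_one_div_lt (sub_pos.2 h)
        exact ⟨n, by linarith⟩
    rw [hU] at h
    refine le_of_tendsto ((ENNReal.tendsto_toReal (measure_ne_top κ _)).comp h)
      (Eventually.of_forall fun n => hlt _ ?_)
    have : (0 : ℝ) < 1 / (n + 1) := by positivity
    linarith
  have h2 : x ≤ κ.real (Iic s) := by
    have h : Tendsto (fun n : ℕ => κ (Iio (s + 1 / (n + 1)))) atTop
        (𝓝 (κ (⋂ n : ℕ, Iio (s + 1 / ((n : ℝ) + 1))))) := by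
      refine tendsto_measure_iInter_atTop (fun n => measurableSet_Iio.nullMeasurableSet)
        (fun m n hmn => Iio_subset_Iio ?_) ⟨0, measure_ne_top _ _⟩
      have : (1 : ℝ) / (n + 1) ≤ 1 / (m + 1) := by gcongr
      linarith
    have hU : (⋂ n : ℕ, Iio (s + 1 / ((n : ℝ) + 1))) = Iic s := by
      ext t
      simp only [mem_iInter, mem_Iic, mem_Iio]
      constructor
      · intro h
        by_contra h'
        obtain ⟨n, hn⟩ := exists_nat_one_div_lt (sub_pos.2 (not_le.1 h'))
        linarith [h n]
      · intro h n
        have : (0 : ℝ) < 1 / (n + 1) := by positivity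
        linarith
    rw [hU] at h
    refine ge_of_tendsto ((ENNReal.tendsto_toReal (measure_ne_top κ _)).comp h)
      (Eventually.of_forall fun n => (hgt _ ?_).le)
    have : (0 : ℝ) < 1 / (n + 1) := by positivity
    linarith
  have hsum := real_Iic_eq (κ := κ) s
  -- At an atom `u` is found by linear interpolation. Without an atom the whole fibre has level `x`,
  -- and `u = 0` puts all of it into `precSet`.
  have hex : ∃ u ∈ Icc (0 : ℝ) 1, timeChange κ (s, u) = x ∧
      ∀ v ∈ Icc (0 : ℝ) 1, timeChange κ (s, v) ≤ x → u ≤ v := by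
    have hk : 0 ≤ κ.real {s} := measureReal_nonneg
    rcases hk.eq_or_lt with hk | hk
    · refine ⟨0, by simp, ?_, fun v hv _ => hv.1⟩
      simp only [timeChange]; linarith
    · refine ⟨(κ.real (Iic s) - x) / κ.real {s}, ⟨?_, ?_⟩, ?_, ?_⟩
      · exact div_nonneg (by linarith) hk.le
      · rw [div_le_one hk]; linarith
      · simp only [timeChange]; field_simp; ring
      · intro v hv hvx
        simp only [timeChange] at hvx
        rw [div_le_iff₀ hk]; linarith
  obtain ⟨u, hu, hux, hmin⟩ := hex
  refine ⟨s, u, hu, hux, Subset.antisymm ?_ ?_⟩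
  · rintro ⟨a, v⟩ ⟨h3, -, h4⟩
    have h3 : timeChange κ (a, v) ≤ x := h3
    have h4 : v ∈ Icc (0 : ℝ) 1 := h4
    rcases lt_trichotomy a s with h | h | h
    · exact Or.inl ⟨h, h4⟩
    · subst h
      exact Or.inr ⟨rfl, hmin v h4 h3, h4.2⟩
    · have := hgt a h
      have := Iio_le_timeChange (κ := κ) (s := a) h4.2
      linarith
  · intro p hp
    refine ⟨?_, trivial, ?_⟩
    · rcases precSet_subset (κ := κ) hp with h | h
      · rw [← hux]; exact h
      · exact absurd h (not_lt.2 hu.2)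
    · rcases hp with h | h
      · exact h.2
      · exact ⟨hu.1.trans h.2.1, h.2.2⟩

/-- This is the probability integral transform with randomized atoms: for `x` strictly between `0`
and the total mass the sublevel set at `x` is, within the strip, a `precSet` of mass `x`.
Nonpositive levels are squeezed by small positive ones. -/
theorem map_timeChange :
    (κ.prod unif).map (timeChange κ) = volume.restrict (Ioc 0 (κ.real univ)) := by
  have key : ∀ x ∈ Ioo 0 (κ.real univ),
      (κ.prod unif) {p | timeChange κ p ≤ x} = ENNReal.ofReal x := by
    intro x hx
    obtain ⟨s, u, hu, h1, h2⟩ := exists_timeChange_eq hx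
    rw [← prod_unif_inter, h2, prod_unif_precSet hu, ← timeChange_eq, h1]
  refine Measure.ext_of_Iic _ _ fun x => ?_
  rw [Measure.map_apply measurable_timeChange measurableSet_Iic,
    Measure.restrict_apply measurableSet_Iic, inter_comm, Ioc_inter_Iic, Real.volume_Ioc]
  change (κ.prod unif) {p | timeChange κ p ≤ x} = _
  rcases le_or_gt (κ.real univ) x with h | h
  · rw [inf_eq_left.2 h, ← prod_unif_inter]
    have : {p | timeChange κ p ≤ x} ∩ univ ×ˢ Icc 0 1 = univ ∩ univ ×ˢ Icc 0 1 := by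
      ext ⟨s, u⟩
      constructor
      · exact fun hp => ⟨trivial, hp.2⟩
      · exact fun hp => ⟨(timeChange_le hp.2.2.1).trans h, hp.2⟩
    rw [this, prod_unif_inter, ← univ_prod_univ, Measure.prod_prod]
    simp
  · rw [inf_eq_right.2 h.le]
    rcases le_or_gt x 0 with h0 | h0
    · rw [ENNReal.ofReal_of_nonpos (by linarith)]
      rcases (measureReal_nonneg : 0 ≤ κ.real univ).eq_or_lt with hz | hz
      · have : κ = 0 := by
          rw [← Measure.measure_univ_eq_zero, ← measureReal_eq_zero_iff]; exact hz.symm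
        simp [this]
      refine le_antisymm (ENNReal.le_of_forall_pos_le_add fun ε hε _ => ?_) bot_le
      have hm : min (ε : ℝ) (κ.real univ / 2) ∈ Ioo 0 (κ.real univ) :=
        ⟨lt_min hε (by linarith), (min_le_right _ _).trans_lt (by linarith)⟩
      rw [zero_add]
      calc (κ.prod unif) {p | timeChange κ p ≤ x}
          ≤ (κ.prod unif) {p | timeChange κ p ≤ min (ε : ℝ) (κ.real univ / 2)} :=
            measure_mono fun p hp => le_trans hp (h0.trans hm.1.le)
        _ = ENNReal.ofReal (min (ε : ℝ) (κ.real univ / 2)) := key _ hm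
        _ ≤ ENNReal.ofReal ε := ENNReal.ofReal_le_ofReal (min_le_left _ _)
        _ = ε := by simp
    · rw [key x ⟨h0, h⟩, sub_zero]

theorem prod_timeChange_le (p : ℝ × ℝ) (hp : p.2 ∈ Icc (0 : ℝ) 1) :
    (κ.prod unif) {q | timeChange κ q ≤ timeChange κ p} = ENNReal.ofReal (timeChange κ p) := by
  have h : (κ.prod unif) {q | timeChange κ q ≤ timeChange κ p} =
      ((κ.prod unif).map (timeChange κ)) (Iic (timeChange κ p)) := by
    rw [Measure.map_apply measurable_timeChange measurableSet_Iic]; rfl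
  rw [h, map_timeChange, Measure.restrict_apply measurableSet_Iic, inter_comm, Ioc_inter_Iic,
    Real.volume_Ioc, inf_eq_right.2 (timeChange_le hp.1), sub_zero]

/-- For `μ ≪ κ`, the `μ ⊗ unif`-mass of the points preceding `(s, u)` in the time of `κ`. -/
theorem prod_timeChange_le_of_ac {μ : Measure ℝ} [IsFiniteMeasure μ] (hμ : μ ≪ κ) {s u : ℝ}
    (hu : u ∈ Icc (0 : ℝ) 1) :
    (μ.prod unif) {q | timeChange κ q ≤ timeChange κ (s, u)} =
      ENNReal.ofReal (μ.real (Iio s) + (1 - u) * μ.real {s}) := by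
  rw [← prod_unif_precSet hu]
  have hsub : precSet s u ⊆ {q | timeChange κ q ≤ timeChange κ (s, u)} := fun q hq =>
    (precSet_subset hq).resolve_right (not_lt.2 hu.2)
  have hmeas : MeasurableSet (precSet s u) :=
    (measurableSet_Iio.prod measurableSet_Icc).union
      ((measurableSet_singleton s).prod measurableSet_Icc)
  -- The sets are nested with equal finite mass under `κ ⊗ unif`; their difference stays null under
  -- `μ ⊗ unif`.
  have h : precSet s u =ᵐ[κ.prod unif] {q | timeChange κ q ≤ timeChange κ (s, u)} := by
    refine ae_eq_of_subset_of_measure_ge hsub ?_ hmeas.nullMeasurableSet (measure_ne_top _ _)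
    rw [prod_timeChange_le _ hu, prod_unif_precSet hu, timeChange_eq]
  exact (measure_congr ((hμ.prod Measure.AbsolutelyContinuous.rfl).ae_eq h)).symm

/-- The time change has a measurable left inverse almost everywhere. -/
theorem exists_inverse_timeChange :
    ∃ σ : ℝ → ℝ, Measurable σ ∧ ∀ᵐ p ∂(κ.prod unif), σ (timeChange κ p) = p.1 := by
  -- The quantile function. It recovers `s` from the time of `(s, u)` when `u < 1` and `κ` charges
  -- every interval ending at `s`.
  let σ : ℝ → ℝ := fun x => sInf {s | x ≤ κ.real (Iic s)}
  have hp : ∀ᵐ p ∂(κ.prod unif), {s | timeChange κ p ≤ κ.real (Iic s)} = Ici p.1 := by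
    have h1 := (Measure.quasiMeasurePreserving_fst (μ := κ) (ν := unif)).ae (ae_measure_Ioc_ne_zero κ)
    have h2 := (Measure.quasiMeasurePreserving_snd (μ := κ) (ν := unif)).ae ae_unif_mem
    filter_upwards [h1, h2] with p h1 h2
    ext t
    simp only [mem_ofPred_eq, mem_Ici]
    constructor
    · intro ht
      by_contra hlt
      rw [not_le] at hlt
      have h3 := h1 t hlt
      have h4 : κ.real (Iic p.1) = κ.real (Iic t) + κ.real (Ioc t p.1) := by
        rw [← Iic_union_Ioc_eq_Iic hlt.le, measureReal_union (by
          rw [Set.disjoint_left]; intro a ha hb; exact not_lt.2 ha hb.1) measurableSet_Ioc]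
      have h5 : κ.real (Ioc t p.1) = κ.real (Ioo t p.1) + κ.real {p.1} := by
        rw [← Ioo_union_right hlt, measureReal_union (by simp) (measurableSet_singleton _)]
      have h6 : 0 < κ.real (Ioc t p.1) := by
        rw [measureReal_def]; exact ENNReal.toReal_pos h3 (measure_ne_top _ _)
      have h7 : 0 ≤ κ.real (Ioo t p.1) := measureReal_nonneg
      have h8 : 0 ≤ κ.real {p.1} := measureReal_nonneg
      simp only [timeChange] at ht
      have h9 : κ.real (Ioo t p.1) + (1 - p.2) * κ.real {p.1} ≤ 0 := by nlinarith
      have h10 : 0 ≤ (1 - p.2) * κ.real {p.1} := mul_nonneg (by linarith [h2.2]) h8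
      have h11 : (1 - p.2) * κ.real {p.1} = 0 := by linarith
      rcases mul_eq_zero.1 h11 with h | h
      · linarith [h2.2]
      · linarith
    · intro ht
      exact (timeChange_le_Iic h2.1.le).trans (measureReal_mono (Iic_subset_Iic.2 ht))
  have hσ : ∀ᵐ p ∂(κ.prod unif), σ (timeChange κ p) = p.1 := by
    filter_upwards [hp] with p hp
    simp only [σ, hp, csInf_Ici]
  -- Monotonicity is claimed only for levels whose defining sets are nonempty and bounded below; a
  -- point of level `x / 2` provides the lower bound.
  have hmono : MonotoneOn σ (Ioo 0 (κ.real univ)) := by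
    intro x hx y hy hxy
    obtain ⟨s, u, hu, h1, -⟩ := exists_timeChange_eq hy
    obtain ⟨s', u', hu', h1', -⟩ := exists_timeChange_eq (κ := κ)
      (x := x / 2) ⟨by linarith [hx.1], by linarith [hx.2, hx.1]⟩
    refine csInf_le_csInf ⟨s', fun t ht => ?_⟩ ⟨s, ?_⟩ fun t ht => hxy.trans ht
    · by_contra hlt
      have h2 : x ≤ κ.real (Iic t) := ht
      have h3 := Iio_le_timeChange (κ := κ) (s := s') hu'.2
      have h4 : κ.real (Iic t) ≤ κ.real (Iio s') :=
        measureReal_mono (Iic_subset_Iio.2 (not_le.1 hlt))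
      linarith [hx.1]
    · change y ≤ _
      rw [← h1]; exact timeChange_le_Iic hu.1
  have hae : AEMeasurable σ ((κ.prod unif).map (timeChange κ)) := by
    rw [map_timeChange, ← restrict_Ioo_eq_restrict_Ioc]
    exact aemeasurable_restrict_of_monotoneOn measurableSet_Ioo hmono
  refine ⟨hae.mk σ, hae.measurable_mk, ?_⟩
  filter_upwards [ae_of_ae_map measurable_timeChange.aemeasurable hae.ae_eq_mk, hσ] with p h1 h2
  rw [← h1, h2]
end

/-! ### The mass balance for finite singular measures. -/

theorem real_Iio_add {μ : Measure ℝ} [IsFiniteMeasure μ] {s t : ℝ} (h : s < t) :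
    μ.real (Iio t) = μ.real (Iio s) + μ.real {s} + μ.real (Ioo s t) := by
  rw [← real_Iic_eq, ← Iic_union_Ioo_eq_Iio h, measureReal_union _ measurableSet_Ioo]
  rw [Set.disjoint_left]; intro a ha hb; exact not_lt.2 ha hb.1

theorem real_Icc_eq {μ : Measure ℝ} [IsFiniteMeasure μ] {s t : ℝ} (h : s < t) :
    μ.real (Icc s t) = μ.real {s} + μ.real (Ioo s t) + μ.real {t} := by
  rw [← Ioc_union_left h.le, ← Ioo_union_right h, measureReal_union _ (measurableSet_singleton _),
    measureReal_union _ (measurableSet_singleton _)]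
  · ring
  · simp
  · simp [h.ne]

theorem lt_iff_real_lt {x y z : ℝ≥0∞} (hx : x ≠ ∞) (hy : y ≠ ∞) (hz : z ≠ ∞) {u : ℝ} (hu : 0 ≤ u) :
    x < ENNReal.ofReal u * y + z ↔ x.toReal < u * y.toReal + z.toReal := by
  have h : ENNReal.ofReal u * y + z ≠ ∞ := by finiteness
  rw [← ENNReal.toReal_lt_toReal hx h, ENNReal.toReal_add (by finiteness) hz, ENNReal.toReal_mul,
    ENNReal.toReal_ofReal hu]

theorem eq_restrict_add_of_mutuallySingular {μ ν : Measure ℝ} (h : μ.MutuallySingular ν) :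
    μ = (μ + ν).restrict h.nullSetᶜ := by
  rw [Measure.restrict_add, Measure.restrict_eq_zero.2 h.measure_compl_nullSet, add_zero]
  refine (Measure.restrict_eq_self_of_ae_mem ?_).symm
  rw [ae_iff]
  simp

/-- Since `σ` reads the position off the time, restricting `μ + ν` to `E` amounts, up to null sets,
to restricting the new time to `σ ⁻¹' E`. Singular measures thus occupy disjoint sets of times, each
with Lebesgue measure on it. -/
theorem map_timeChange_of_singular {μ ν : Measure ℝ} [IsFiniteMeasure μ] [IsFiniteMeasure ν]
    {E : Set ℝ} (hE : MeasurableSet E) (hμ : μ = (μ + ν).restrict E) {σ : ℝ → ℝ}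
    (hσ : Measurable σ)
    (hσ' : ∀ᵐ p ∂((μ + ν).prod unif), σ (timeChange (μ + ν) p) = p.1) :
    (μ.prod unif).map (timeChange (μ + ν)) =
      volume.restrict (σ ⁻¹' E ∩ Ioc 0 ((μ + ν).real univ)) := by
  have h1 : μ.prod unif = ((μ + ν).prod unif).restrict (timeChange (μ + ν) ⁻¹' (σ ⁻¹' E)) := by
    have : μ.prod unif = ((μ + ν).prod unif).restrict (E ×ˢ univ) := by
      rw [← Measure.prod_restrict, ← hμ, Measure.restrict_univ]
    rw [this]
    refine Measure.restrict_congr_set ?_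
    filter_upwards [hσ'] with p hp
    apply propext
    constructor
    · intro h
      change σ _ ∈ E
      rw [hp]; exact h.1
    · intro h
      refine ⟨?_, trivial⟩
      change σ _ ∈ E at h
      rwa [hp] at h
  conv_lhs => rw [h1]
  rw [← Measure.restrict_map measurable_timeChange (hσ hE), map_timeChange,
    Measure.restrict_restrict (hσ hE)]

/-- The mass balance for finite singular measures `μ`, `ν` on `(-∞, b]`: the part of `μ` that is
not absorbed by `ν` before `b` equals the final height of the path `μ - ν` above its minimum. -/
theorem prod_noReturn_of_finite {μ ν : Measure ℝ} [IsFiniteMeasure μ] [IsFiniteMeasure ν]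
    (hsing : μ.MutuallySingular ν) {b : ℝ} (hμb : μ (Ioi b) = 0) (hνb : ν (Ioi b) = 0) :
    (μ.prod unif) {p | p.1 ≤ b ∧ ∀ t ∈ Ioc p.1 b,
        ν (Icc p.1 t) < ENNReal.ofReal p.2 * μ {p.1} + μ (Ioo p.1 t)} =
      ENNReal.ofReal (μ.real (Iic b) - ν.real (Iic b) -
        sInf {x | x = 0 ∨ ∃ t ≤ b, x = μ.real (Iic t) - ν.real (Iic t) ∨
          x = μ.real (Iio t) - ν.real (Iio t)}) := by
  classical
  set κ := μ + ν with hκ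
  set L := κ.real univ with hL
  set φ := timeChange κ with hφ
  obtain ⟨σ, hσ, hσ'⟩ := exists_inverse_timeChange (κ := κ)
  set E := hsing.nullSetᶜ with hE
  have hEm : MeasurableSet E := hsing.measurableSet_nullSet.compl
  have hνE : ν E = 0 := hsing.measure_compl_nullSet
  have hμE : μ = (μ + ν).restrict E := eq_restrict_add_of_mutuallySingular hsing
  have hνE' : ν = (ν + μ).restrict Eᶜ := by
    rw [Measure.restrict_add, hE, compl_compl, Measure.restrict_eq_zero.2 hsing.measure_nullSet,
      add_zero]
    refine (Measure.restrict_eq_self_of_ae_mem ?_).symm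
    rw [ae_iff]; exact hνE
  -- The times at which the clock runs on `μ`; the path has slope `1` there and `-1` elsewhere.
  set D := σ ⁻¹' E with hD
  have hDm : MeasurableSet D := hσ hEm
  have hmapμ : (μ.prod unif).map φ = volume.restrict (D ∩ Ioc 0 L) :=
    map_timeChange_of_singular hEm hμE hσ hσ'
  have hmapν : (ν.prod unif).map φ = volume.restrict (Dᶜ ∩ Ioc 0 L) := by
    have := map_timeChange_of_singular (μ := ν) (ν := μ) hEm.compl hνE' hσ (by
      rw [add_comm]; exact hσ')
    rw [add_comm ν μ] at this
    exact this
  have hφm : Measurable φ := measurable_timeChange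
  let f : ℝ → ℝ := fun x => D.indicator 1 x - Dᶜ.indicator 1 x
  have hf1 : ∀ x ∈ D, f x = 1 := fun x hx => by simp [f, hx]
  have hf2 : ∀ x ∉ D, f x = -1 := fun x hx => by simp [f, hx]
  have hf : ∀ x, f x = 1 ∨ f x = -1 := fun x => by
    by_cases h : x ∈ D
    · exact Or.inl (hf1 x h)
    · exact Or.inr (hf2 x h)
  have hfm : Measurable f :=
    (measurable_const.indicator hDm).sub (measurable_const.indicator hDm.compl)
  have hfb : ∀ x, ‖f x‖ ≤ 1 := fun x => by rcases hf x with h | h <;> simp [h]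
  have hloc : LocallyIntegrable f volume := by
    have h1 : LocallyIntegrable (fun _ : ℝ => (1 : ℝ)) volume := locallyIntegrable_const 1
    exact h1.mono hfm.aestronglyMeasurable (Filter.Eventually.of_forall fun x => by simpa using hfb x)
  let g : ℝ → ℝ := fun x => ∫ t in (0)..x, f t
  have hii : ∀ x y, IntervalIntegrable f volume x y := fun x y =>
    intervalIntegrable_iff.mpr
      ((hloc.integrableOn_isCompact isCompact_uIcc).mono_set uIoc_subset_uIcc)
  have hg : LipschitzWith 1 g := by
    refine LipschitzWith.of_dist_le_mul fun x y => ?_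
    rw [Real.dist_eq, Real.dist_eq, NNReal.coe_one]
    simp only [g]
    rw [intervalIntegral.integral_interval_sub_left (hii _ _) (hii _ _)]
    exact intervalIntegral.norm_integral_le_of_norm_le_const fun z _ => hfb z
  have hd : ∀ᵐ x, HasDerivAt g (f x) x := by
    filter_upwards [_root_.LocallyIntegrable.ae_hasDerivAt_integral hloc] with x hx using hx 0
  have hL0 : 0 ≤ L := measureReal_nonneg
  obtain ⟨hRm, hR⟩ := volume_noReturn hg hd hf hL0
  set R := {x | x ∈ Ioc 0 L ∧ f x = 1 ∧ ∀ y ∈ Ioc x L, g x < g y} with hRdef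
  have hRD : R ⊆ D ∩ Ioc 0 L := fun x hx => by
    refine ⟨?_, hx.1⟩
    by_contra h
    have := hx.2.1
    rw [hf2 x h] at this
    norm_num at this
  -- the path in the new time
  have hgint : ∀ y ∈ Icc 0 L, g y = ((μ.prod unif) {q | φ q ≤ y}).toReal -
      ((ν.prod unif) {q | φ q ≤ y}).toReal := by
    intro y hy
    have h1 : (μ.prod unif) {q | φ q ≤ y} = volume (D ∩ Ioc 0 y) := by
      have : (μ.prod unif) {q | φ q ≤ y} = ((μ.prod unif).map φ) (Iic y) := by
        rw [Measure.map_apply hφm measurableSet_Iic]; rfl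
      rw [this, hmapμ, Measure.restrict_apply measurableSet_Iic, inter_comm, inter_assoc,
        Ioc_inter_Iic, inf_eq_right.2 hy.2]
    have h2 : (ν.prod unif) {q | φ q ≤ y} = volume (Dᶜ ∩ Ioc 0 y) := by
      have : (ν.prod unif) {q | φ q ≤ y} = ((ν.prod unif).map φ) (Iic y) := by
        rw [Measure.map_apply hφm measurableSet_Iic]; rfl
      rw [this, hmapν, Measure.restrict_apply measurableSet_Iic, inter_comm, inter_assoc,
        Ioc_inter_Iic, inf_eq_right.2 hy.2]
    have hi : ∀ A : Set ℝ, MeasurableSet A →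
        Integrable (A.indicator (1 : ℝ → ℝ)) (volume.restrict (Ioc 0 y)) := fun A hA =>
      (integrable_const (1 : ℝ)).indicator hA
    simp only [g, f]
    rw [intervalIntegral.integral_of_le hy.1, integral_sub (hi _ hDm) (hi _ hDm.compl),
      integral_indicator_one hDm, integral_indicator_one hDm.compl, h1, h2, measureReal_def,
      measureReal_def, Measure.restrict_apply hDm, Measure.restrict_apply hDm.compl]
  have hφmem : ∀ s, ∀ u ∈ Icc (0 : ℝ) 1, φ (s, u) ∈ Icc 0 L := fun s u hu =>
    ⟨timeChange_nonneg hu.2, timeChange_le hu.1⟩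
  have hgφ : ∀ s, ∀ u ∈ Icc (0 : ℝ) 1, g (φ (s, u)) =
      (μ.real (Iio s) + (1 - u) * μ.real {s}) - (ν.real (Iio s) + (1 - u) * ν.real {s}) := by
    intro s u hu
    have hμκ : μ ≪ κ := (Measure.le_add_right le_rfl).absolutelyContinuous
    have hνκ : ν ≪ κ := (Measure.le_add_left le_rfl).absolutelyContinuous
    have h3 : 0 ≤ 1 - u := by linarith [hu.2]
    rw [hgint _ (hφmem s u hu), prod_timeChange_le_of_ac hμκ hu, prod_timeChange_le_of_ac hνκ hu,
      ENNReal.toReal_ofReal (by positivity), ENNReal.toReal_ofReal (by positivity)]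
  have h01 : (0 : ℝ) ∈ Icc (0 : ℝ) 1 := by simp
  have h11 : (1 : ℝ) ∈ Icc (0 : ℝ) 1 := by simp
  have hg0 : g 0 = 0 := by simp [g]
  have hgIic : ∀ t, g (φ (t, 0)) = μ.real (Iic t) - ν.real (Iic t) := fun t => by
    rw [hgφ t 0 h01, real_Iic_eq, real_Iic_eq]; ring
  have hgIio : ∀ t, g (φ (t, 1)) = μ.real (Iio t) - ν.real (Iio t) := fun t => by
    rw [hgφ t 1 h11]; ring
  have hκb : κ (Ioi b) = 0 := by rw [hκ, Measure.add_apply, hμb, hνb, add_zero]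
  have hLge : ∀ t, b ≤ t → κ.real (Iic t) = L := by
    intro t ht
    have h0 : κ (Ioi t) = 0 := measure_mono_null (Ioi_subset_Ioi ht) hκb
    rw [hL, measureReal_def, measureReal_def, ← Iic_union_Ioi (a := t),
      measure_union (by simp) measurableSet_Ioi, h0, add_zero]
  have hLb : φ (b, 0) = L := by simp only [hφ, timeChange]; rw [hLge b le_rfl]; ring
  -- every point of the new time comes from a point of the line
  have hcover : ∀ y ∈ Ioc 0 L, ∃ t ≤ b, ∃ v ∈ Icc (0 : ℝ) 1, φ (t, v) = y := by
    intro y hy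
    rcases hy.2.eq_or_lt with h | h
    · exact ⟨b, le_rfl, 0, h01, by rw [hLb, h]⟩
    · obtain ⟨t, v, hv, h1, -⟩ := exists_timeChange_eq ⟨hy.1, h⟩
      refine ⟨t, ?_, v, hv, h1⟩
      by_contra hbt
      rw [not_le] at hbt
      have h2 := Iio_le_timeChange (κ := κ) (s := t) hv.2
      have h3 : κ.real (Iic b) ≤ κ.real (Iio t) := measureReal_mono (Iic_subset_Iio.2 hbt)
      rw [hLge b le_rfl] at h3
      linarith
  -- Inside a fibre the new path interpolates linearly between the left limit and the value at `t`,
  -- so spreading the atoms does not change the infimum.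
  have hV : sInf (g '' Icc 0 L) = sInf {x | x = 0 ∨ ∃ t ≤ b, x = μ.real (Iic t) - ν.real (Iic t) ∨
      x = μ.real (Iio t) - ν.real (Iio t)} := by
    have hbdd : BddBelow (g '' Icc 0 L) :=
      (isCompact_Icc.image hg.continuous).bddBelow
    have hsub : {x | x = 0 ∨ ∃ t ≤ b, x = μ.real (Iic t) - ν.real (Iic t) ∨
        x = μ.real (Iio t) - ν.real (Iio t)} ⊆ g '' Icc 0 L := by
      rintro x (h | ⟨t, -, h | h⟩)
      · exact ⟨0, ⟨le_rfl, hL0⟩, by rw [h, hg0]⟩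
      · exact ⟨_, hφmem t 0 h01, by rw [h, hgIic]⟩
      · exact ⟨_, hφmem t 1 h11, by rw [h, hgIio]⟩
    refine le_antisymm (csInf_le_csInf hbdd ⟨0, Or.inl rfl⟩ hsub) ?_
    refine le_csInf ⟨_, 0, ⟨le_rfl, hL0⟩, rfl⟩ ?_
    rintro _ ⟨y, hy, rfl⟩
    have hbdd' := hbdd.mono hsub
    rcases hy.1.eq_or_lt with h | h
    · rw [← h, hg0]
      exact csInf_le hbdd' (Or.inl rfl)
    · obtain ⟨t, ht, v, hv, rfl⟩ := hcover y ⟨h, hy.2⟩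
      have h1 := csInf_le hbdd' (Or.inr ⟨t, ht, Or.inl rfl⟩)
      have h2 := csInf_le hbdd' (Or.inr ⟨t, ht, Or.inr rfl⟩)
      rw [hgφ t v hv]
      rw [real_Iic_eq, real_Iic_eq] at h1
      nlinarith [hv.1, hv.2]
  -- identification of the two sets
  have hae : {p : ℝ × ℝ | p.1 ≤ b ∧ ∀ t ∈ Ioc p.1 b,
      ν (Icc p.1 t) < ENNReal.ofReal p.2 * μ {p.1} + μ (Ioo p.1 t)} =ᵐ[μ.prod unif] φ ⁻¹' R := by
    have a1 : ∀ᵐ p ∂(μ.prod unif), p.1 ∈ E ∧ p.1 ≤ b ∧ ∀ t, p.1 < t → κ (Ico p.1 t) ≠ 0 := by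
      refine (Measure.quasiMeasurePreserving_fst (μ := μ) (ν := unif)).ae
        (p := fun s => s ∈ E ∧ s ≤ b ∧ ∀ t, s < t → κ (Ico s t) ≠ 0) ?_
      have hμκ : μ ≪ κ := (Measure.le_add_right le_rfl).absolutelyContinuous
      have b1 : ∀ᵐ s ∂μ, s ∈ E := by rw [ae_iff]; simp [hE]
      have b2 : ∀ᵐ s ∂μ, s ≤ b := by
        rw [ae_iff]; simp only [not_le]; exact hμb
      filter_upwards [b1, b2, hμκ.ae_le (ae_measure_Ico_ne_zero κ)] with s h1 h2 h3
      exact ⟨h1, h2, h3⟩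
    have a2 := (Measure.quasiMeasurePreserving_snd (μ := μ) (ν := unif)).ae ae_unif_mem
    have a3 : ∀ᵐ p ∂(μ.prod unif), φ p ∈ D ∩ Ioc 0 L := by
      refine ae_of_ae_map hφm.aemeasurable ?_
      rw [hmapμ]
      exact ae_restrict_mem (hDm.inter measurableSet_Ioc)
    filter_upwards [a1, a2, a3] with ⟨s, u⟩ h1 h2 h3
    obtain ⟨hsE, hsb, hpos⟩ := h1
    have hu : u ∈ Icc (0 : ℝ) 1 := ⟨h2.1.le, h2.2.le⟩
    have hu0 : 0 < u := h2.1
    have hνs : ν.real {s} = 0 := by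
      rw [measureReal_eq_zero_iff]
      exact measure_mono_null (singleton_subset_iff.2 hsE) hνE
    have hgx := hgφ s u hu
    rw [hνs] at hgx
    have hiff : ∀ t, ν (Icc s t) < ENNReal.ofReal u * μ {s} + μ (Ioo s t) ↔
        ν.real (Icc s t) < u * μ.real {s} + μ.real (Ioo s t) := fun t =>
      lt_iff_real_lt (measure_ne_top _ _) (measure_ne_top _ _) (measure_ne_top _ _) hu0.le
    have hκreal : ∀ A, κ.real A = μ.real A + ν.real A := fun A => by
      rw [hκ, measureReal_add_apply]
    apply propext
    change (s ≤ b ∧ ∀ t ∈ Ioc s b, ν (Icc s t) < ENNReal.ofReal u * μ {s} + μ (Ioo s t)) ↔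
      φ (s, u) ∈ R
    constructor
    · rintro ⟨-, hst⟩
      refine ⟨h3.2, hf1 _ h3.1, fun y hy => ?_⟩
      obtain ⟨t, htb, v, hv, rfl⟩ := hcover y ⟨h3.2.1.trans hy.1, hy.2⟩
      rw [hgx, hgφ t v hv]
      rcases lt_trichotomy t s with h | h | h
      · exfalso
        have c1 : φ (t, v) ≤ κ.real (Iic t) := timeChange_le_Iic hv.1
        have c2 : κ.real (Iic t) ≤ κ.real (Iio s) := measureReal_mono (Iic_subset_Iio.2 h)
        have c3 : κ.real (Iio s) ≤ φ (s, u) := Iio_le_timeChange hu.2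
        linarith [hy.1]
      · subst h
        have := hy.1
        simp only [hφ, timeChange_eq] at this
        rw [hκreal {t}, hνs] at this
        rw [hνs]
        linarith
      · have c1 := (hiff t).1 (hst t ⟨h, htb⟩)
        rw [real_Icc_eq h, hνs] at c1
        rw [real_Iio_add (μ := μ) h, real_Iio_add (μ := ν) h, hνs]
        have c2 : 0 ≤ v * ν.real {t} := mul_nonneg hv.1 measureReal_nonneg
        have c3 : 0 ≤ (1 - v) * μ.real {t} := mul_nonneg (by linarith [hv.2]) measureReal_nonneg
        linarith
    · rintro ⟨-, -, hlt⟩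
      refine ⟨hsb, fun t ht => (hiff t).2 ?_⟩
      -- Strictness needs both `u > 0` and mass of `κ` in `[s, t)`.
      have hlow : φ (s, u) < κ.real (Iio t) := by
        rw [hφ, timeChange_eq, real_Iio_add ht.1]
        have c1 := hpos t ht.1
        have c2 : κ.real (Ico s t) = κ.real {s} + κ.real (Ioo s t) := by
          rw [← Ioo_union_left ht.1, measureReal_union (by simp) (measurableSet_singleton s),
            add_comm]
        have c3 : 0 < κ.real (Ico s t) := by
          rw [measureReal_def]; exact ENNReal.toReal_pos c1 (measure_ne_top _ _)
        have c4 : 0 ≤ κ.real {s} := measureReal_nonneg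
        have c5 : 0 ≤ κ.real (Ioo s t) := measureReal_nonneg
        by_contra hcon
        have c6 : u * κ.real {s} + κ.real (Ioo s t) ≤ 0 := by linarith
        have c7 : 0 ≤ u * κ.real {s} := mul_nonneg hu0.le c4
        have c8 : u * κ.real {s} = 0 := by linarith
        rcases mul_eq_zero.1 c8 with c | c <;> linarith
      rw [real_Icc_eq ht.1, hνs]
      -- The condition at `t` counts the atom of `ν` at `t` but not that of `μ`. Without an atom of
      -- `ν` it is the path before `t` (`v = 1`); otherwise singularity gives `μ{t} = 0` and it is
      -- the path after `t` (`v = 0`).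
      by_cases hνt : ν.real {t} = 0
      · have c1 := hlt (φ (t, 1)) ⟨hlow.trans_le (Iio_le_timeChange le_rfl), (hφmem t 1 h11).2⟩
        rw [hgx, hgφ t 1 h11, real_Iio_add (μ := μ) ht.1, real_Iio_add (μ := ν) ht.1, hνs] at c1
        rw [hνt]; linarith
      · have hμt : μ.real {t} = 0 := by
          rw [measureReal_eq_zero_iff]
          by_contra hne
          have htE : t ∈ E := by
            by_contra h
            exact hne (measure_mono_null (singleton_subset_iff.2 (not_notMem.1 h))
              hsing.measure_nullSet)
          exact hνt ((measureReal_eq_zero_iff).2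
            (measure_mono_null (singleton_subset_iff.2 htE) hνE))
        have c1 := hlt (φ (t, 0)) ⟨hlow.trans_le (Iio_le_timeChange zero_le_one),
          (hφmem t 0 h01).2⟩
        rw [hgx, hgφ t 0 h01, real_Iio_add (μ := μ) ht.1, real_Iio_add (μ := ν) ht.1, hνs,
          hμt] at c1
        linarith
  rw [measure_congr hae, ← hV, ← hgIic b, hLb, ← hR]
  have hRm' : NullMeasurableSet R ((μ.prod unif).map φ) := by
    rw [hmapμ]; exact hRm.mono_ac Measure.absolutelyContinuous_restrict
  rw [← Measure.map_apply₀ hφm.aemeasurable hRm', hmapμ, Measure.restrict_apply₀' (by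
    exact (hDm.inter measurableSet_Ioc).nullMeasurableSet), inter_eq_self_of_subset_left hRD]

/-! ### Hitting times for locally finite measures and the mass transported into an interval. -/

open Filter Topology in
theorem exists_measure_Icc_lt {ν : Measure ℝ} [IsLocallyFiniteMeasure ν] {a b : ℝ} {y : ℝ≥0∞}
    (h : ν (Icc a b) < y) : ∃ ε > 0, ν (Icc (a - ε) (b + ε)) < y := by
  have ht : Tendsto (fun n : ℕ => ν (Icc (a - 1 / (n + 1)) (b + 1 / (n + 1)))) atTop
      (𝓝 (ν (⋂ n : ℕ, Icc (a - 1 / ((n : ℝ) + 1)) (b + 1 / ((n : ℝ) + 1))))) := by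
    refine tendsto_measure_iInter_atTop (fun n => measurableSet_Icc.nullMeasurableSet)
      (fun m n hmn => ?_) ⟨0, measure_Icc_lt_top.ne⟩
    have : (1 : ℝ) / (n + 1) ≤ 1 / (m + 1) := by gcongr
    exact Icc_subset_Icc (by linarith) (by linarith)
  have hI : (⋂ n : ℕ, Icc (a - 1 / ((n : ℝ) + 1)) (b + 1 / ((n : ℝ) + 1))) = Icc a b := by
    ext t
    simp only [mem_iInter, mem_Icc]
    constructor
    · intro h
      constructor
      · by_contra h'
        obtain ⟨n, hn⟩ := exists_nat_one_div_lt (sub_pos.2 (not_le.1 h'))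
        linarith [(h n).1]
      · by_contra h'
        obtain ⟨n, hn⟩ := exists_nat_one_div_lt (sub_pos.2 (not_le.1 h'))
        linarith [(h n).2]
    · intro h n
      have : (0 : ℝ) < 1 / (n + 1) := by positivity
      exact ⟨by linarith [h.1], by linarith [h.2]⟩
  rw [hI] at ht
  obtain ⟨n, hn⟩ := (ht.eventually (gt_mem_nhds h)).exists
  exact ⟨1 / (n + 1), by positivity, hn⟩

/-- The values and left limits of the path `μ - ν` on `[c, b]`, started at `0` in `c`. -/
def pathValues (μ ν : Measure ℝ) (c b : ℝ) : Set ℝ :=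
  {x | x = 0 ∨ ∃ t ≤ b, x = μ.real (Ioc c t) - ν.real (Ioc c t) ∨
    x = μ.real (Ioo c t) - ν.real (Ioo c t)}

/-- The first time after `s` at which `ν` has absorbed the part `u μ{s}` of the atom at `s` and
the mass of `μ` after `s`. -/
noncomputable def hit (μ ν : Measure ℝ) (u s : ℝ) : EReal :=
  sInf ((fun t : ℝ => (t : EReal)) ''
    {t : ℝ | s < t ∧ ENNReal.ofReal u * μ {s} + μ (Ioo s t) ≤ ν (Icc s t)})

theorem le_hit (μ ν : Measure ℝ) (u s : ℝ) : (s : EReal) ≤ hit μ ν u s := by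
  refine le_sInf ?_
  rintro _ ⟨t, ht, rfl⟩
  exact EReal.coe_le_coe_iff.2 ht.1.le

theorem hit_ne_bot (μ ν : Measure ℝ) (u s : ℝ) : hit μ ν u s ≠ ⊥ :=
  fun h => by simpa [h] using le_hit μ ν u s

theorem hit_eq_top_iff (μ ν : Measure ℝ) (u s : ℝ) : hit μ ν u s = ⊤ ↔
    ∀ t, s < t → ν (Icc s t) < ENNReal.ofReal u * μ {s} + μ (Ioo s t) := by
  rw [hit, sInf_eq_top]
  constructor
  · intro h t hst
    by_contra hn
    exact EReal.coe_ne_top t (h _ ⟨t, ⟨hst, not_lt.1 hn⟩, rfl⟩)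
  · rintro h _ ⟨t, ht, rfl⟩
    exact absurd (h t ht.1) (not_lt.2 ht.2)

/-- The defining inequality survives limits from the right: `ν (Icc s t)` is right-continuous and `μ
(Ioo s t)` only shrinks. The second alternative is kept separate because `b = s` is not an
admissible time. -/
theorem exists_of_hit_le {μ ν : Measure ℝ} [IsLocallyFiniteMeasure ν] {u s b : ℝ}
    (h : hit μ ν u s ≤ b) :
    (∃ t ∈ Ioc s b, ENNReal.ofReal u * μ {s} + μ (Ioo s t) ≤ ν (Icc s t)) ∨
      ENNReal.ofReal u * μ {s} + μ (Ioo s b) ≤ ν (Icc s b) := by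
  by_contra hn
  push Not at hn
  obtain ⟨ε, hε, hlt⟩ := exists_measure_Icc_lt hn.2
  have h1 : hit μ ν u s < ((b + ε : ℝ) : EReal) :=
    h.trans_lt (EReal.coe_lt_coe_iff.2 (by linarith))
  obtain ⟨_, ⟨t, ⟨h2, h3⟩, rfl⟩, h4⟩ := sInf_lt_iff.1 h1
  have h4 : t < b + ε := EReal.coe_lt_coe_iff.1 h4
  rcases le_or_gt t b with h5 | h5
  · exact absurd h3 (not_le.2 (hn.1 t ⟨h2, h5⟩))
  · have : ENNReal.ofReal u * μ {s} + μ (Ioo s b) ≤ ν (Icc (s - ε) (b + ε)) :=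
      calc _ ≤ ENNReal.ofReal u * μ {s} + μ (Ioo s t) := by gcongr
        _ ≤ ν (Icc s t) := h3
        _ ≤ _ := measure_mono (Icc_subset_Icc (by linarith) h4.le)
    exact absurd hlt (not_lt.2 this)

theorem hit_le_iff {μ ν : Measure ℝ} [IsLocallyFiniteMeasure ν] {u s b : ℝ} (hsb : s < b) :
    hit μ ν u s ≤ b ↔
      ∃ t ∈ Ioc s b, ENNReal.ofReal u * μ {s} + μ (Ioo s t) ≤ ν (Icc s t) := by
  constructor
  · intro h
    rcases exists_of_hit_le h with h | h
    · exact h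
    · exact ⟨b, ⟨hsb, le_rfl⟩, h⟩
  · rintro ⟨t, ht, h⟩
    have h1 : hit μ ν u s ≤ (t : EReal) := sInf_le ⟨t, ⟨ht.1, h⟩, rfl⟩
    exact h1.trans (EReal.coe_le_coe_iff.2 ht.2)

theorem lt_hit_self {μ ν : Measure ℝ} [IsLocallyFiniteMeasure ν] {u s : ℝ} (hu : 0 < u)
    (hμ : μ {s} ≠ 0) (hν : ν {s} = 0) : (s : EReal) < hit μ ν u s := by
  by_contra h
  rcases exists_of_hit_le (not_lt.1 h) with ⟨t, ht, -⟩ | h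
  · exact absurd ht.1 (not_lt.2 ht.2)
  · simp only [Ioo_self, measure_empty, add_zero, Icc_self, hν, nonpos_iff_eq_zero, mul_eq_zero,
      ENNReal.ofReal_eq_zero, hμ, or_false] at h
    exact absurd hu (not_lt.2 h)

theorem bddBelow_pathValues {μ ν : Measure ℝ} [IsLocallyFiniteMeasure ν] (c b : ℝ) : BddBelow (pathValues μ ν c b) := by
  refine ⟨-ν.real (Ioc c b), ?_⟩
  have hle : ∀ A ⊆ Ioc c b, ν.real A ≤ ν.real (Ioc c b) := fun A hA =>
    measureReal_mono hA measure_Ioc_lt_top.ne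
  rintro x (h | ⟨t, ht, h | h⟩)
  · rw [h]; simp
  · have := hle _ (Ioc_subset_Ioc_right ht : Ioc c t ⊆ Ioc c b)
    have : 0 ≤ μ.real (Ioc c t) := measureReal_nonneg
    rw [h]; linarith
  · have := hle _ (fun x hx => ⟨hx.1, hx.2.le.trans ht⟩ : Ioo c t ⊆ Ioc c b)
    have : 0 ≤ μ.real (Ioo c t) := measureReal_nonneg
    rw [h]; linarith

section
variable {μ ν : Measure ℝ} [IsLocallyFiniteMeasure μ] [IsLocallyFiniteMeasure ν]

/-- The finite balance is applied to the restrictions to `Ioc c b`. Its no-return condition agrees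
with `b < hit` except possibly at `s = b`, where it is vacuous: if `b` is an atom of `μ`, then
`lt_hit_self` applies for almost every `u`, and otherwise `b` is null. -/
theorem prod_lt_hit (hsing : μ.MutuallySingular ν) {c b : ℝ} :
    (μ.prod unif) {p | p.1 ∈ Ioc c b ∧ (b : EReal) < hit μ ν p.2 p.1} =
      ENNReal.ofReal (μ.real (Ioc c b) - ν.real (Ioc c b) - sInf (pathValues μ ν c b)) := by
  have hfμ : IsFiniteMeasure (μ.restrict (Ioc c b)) := ⟨by simp [measure_Ioc_lt_top]⟩
  have hfν : IsFiniteMeasure (ν.restrict (Ioc c b)) := ⟨by simp [measure_Ioc_lt_top]⟩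
  have hIoi : ∀ ρ : Measure ℝ, ρ.restrict (Ioc c b) (Ioi b) = 0 := fun ρ => by
    rw [Measure.restrict_apply measurableSet_Ioi]
    convert measure_empty (μ := ρ)
    ext x; simp only [mem_inter_iff, mem_Ioi, mem_Ioc, mem_empty_iff_false, iff_false]
    rintro ⟨h1, -, h2⟩; linarith
  have hsing' : (μ.restrict (Ioc c b)).MutuallySingular (ν.restrict (Ioc c b)) :=
    (hsing.restrict _).symm.restrict _ |>.symm
  have h := prod_noReturn_of_finite hsing' (hIoi μ) (hIoi ν)
  have hIic : ∀ ρ : Measure ℝ, ∀ t ≤ b, (ρ.restrict (Ioc c b)).real (Iic t) = ρ.real (Ioc c t) := by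
    intro ρ t ht
    rw [measureReal_restrict_apply measurableSet_Iic, inter_comm, Ioc_inter_Iic, inf_eq_right.2 ht]
  have hIio : ∀ ρ : Measure ℝ, ∀ t ≤ b, (ρ.restrict (Ioc c b)).real (Iio t) = ρ.real (Ioo c t) := by
    intro ρ t ht
    rw [measureReal_restrict_apply measurableSet_Iio]
    congr 1
    ext x
    simp only [mem_inter_iff, mem_Iio, mem_Ioc, mem_Ioo]
    exact ⟨fun h => ⟨h.2.1, h.1⟩, fun h => ⟨h.2, h.1, h.2.le.trans ht⟩⟩
  have hV : {x | x = 0 ∨ ∃ t ≤ b, x = (μ.restrict (Ioc c b)).real (Iic t) -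
      (ν.restrict (Ioc c b)).real (Iic t) ∨ x = (μ.restrict (Ioc c b)).real (Iio t) -
      (ν.restrict (Ioc c b)).real (Iio t)} = pathValues μ ν c b := by
    ext x
    refine or_congr Iff.rfl (exists_congr fun t => and_congr_right fun ht => ?_)
    rw [hIic μ t ht, hIic ν t ht, hIio μ t ht, hIio ν t ht]
  rw [hV, hIic μ b le_rfl, hIic ν b le_rfl] at h
  rw [← h]
  have hprod : (μ.restrict (Ioc c b)).prod unif = (μ.prod unif).restrict (Ioc c b ×ˢ univ) := by
    rw [← Measure.prod_restrict, Measure.restrict_univ]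
  rw [hprod, Measure.restrict_apply' (measurableSet_Ioc.prod MeasurableSet.univ)]
  refine measure_congr ?_
  have a1 : ∀ᵐ p ∂(μ.prod unif), ν {p.1} = 0 ∧
      (μ {p.1} = 0 → p.1 ≠ b) := by
    refine (Measure.quasiMeasurePreserving_fst (μ := μ) (ν := unif)).ae
      (p := fun s => ν {s} = 0 ∧ (μ {s} = 0 → s ≠ b)) ?_
    have b1 : ∀ᵐ s ∂μ, ν {s} = 0 := by
      have : ∀ᵐ s ∂μ, s ∉ hsing.nullSet := by rw [ae_iff]; simp
      filter_upwards [this] with s hs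
      exact measure_mono_null (singleton_subset_iff.2 hs) hsing.measure_compl_nullSet
    have b2 : ∀ᵐ s ∂μ, μ {s} = 0 → s ≠ b := by
      by_cases hb : μ {b} = 0
      · have : ∀ᵐ s ∂μ, s ≠ b := by
          rw [ae_iff]; simpa using hb
        filter_upwards [this] with s hs _ using hs
      · refine Filter.Eventually.of_forall fun s hs hsb => hb ?_
        rw [← hsb]; exact hs
    filter_upwards [b1, b2] with s h1 h2
    exact ⟨h1, h2⟩
  have a2 := (Measure.quasiMeasurePreserving_snd (μ := μ) (ν := unif)).ae ae_unif_mem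
  filter_upwards [a1, a2] with ⟨s, u⟩ h1 h2
  apply propext
  change (s ∈ Ioc c b ∧ (b : EReal) < hit μ ν u s) ↔
    (s ≤ b ∧ ∀ t ∈ Ioc s b, ν.restrict (Ioc c b) (Icc s t) <
      ENNReal.ofReal u * μ.restrict (Ioc c b) {s} + μ.restrict (Ioc c b) (Ioo s t)) ∧
      s ∈ Ioc c b ∧ u ∈ univ
  have hloc : s ∈ Ioc c b → ∀ t ∈ Ioc s b, (ν.restrict (Ioc c b) (Icc s t) <
      ENNReal.ofReal u * μ.restrict (Ioc c b) {s} + μ.restrict (Ioc c b) (Ioo s t) ↔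
      ν (Icc s t) < ENNReal.ofReal u * μ {s} + μ (Ioo s t)) := by
    intro hs t ht
    rw [Measure.restrict_eq_self, Measure.restrict_eq_self, Measure.restrict_eq_self]
    · exact fun x hx => ⟨hs.1.trans hx.1, hx.2.le.trans ht.2⟩
    · exact singleton_subset_iff.2 hs
    · exact fun x hx => ⟨hs.1.trans_le hx.1, hx.2.trans ht.2⟩
  have hmain : s ∈ Ioc c b → ((b : EReal) < hit μ ν u s ↔
      ∀ t ∈ Ioc s b, ν (Icc s t) < ENNReal.ofReal u * μ {s} + μ (Ioo s t)) := by
    intro hs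
    rcases hs.2.eq_or_lt with h3 | h3
    · have h4 : μ {s} ≠ 0 := fun h => h1.2 h h3
      have := lt_hit_self h2.1 h4 h1.1
      rw [h3] at this ⊢
      simp [this]
    · rw [← not_le, hit_le_iff h3]
      push Not
      rfl
  constructor
  · rintro ⟨hs, h3⟩
    exact ⟨⟨hs.2, fun t ht => (hloc hs t ht).2 ((hmain hs).1 h3 t ht)⟩, hs, trivial⟩
  · rintro ⟨⟨-, h3⟩, hs, -⟩
    exact ⟨hs, (hmain hs).2 fun t ht => (hloc hs t ht).1 (h3 t ht)⟩

theorem real_Ioc_add (ρ : Measure ℝ) [IsLocallyFiniteMeasure ρ] {c a b : ℝ} (h1 : c ≤ a)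
    (h2 : a ≤ b) : ρ.real (Ioc c b) = ρ.real (Ioc c a) + ρ.real (Ioc a b) := by
  rw [← Ioc_union_Ioc_eq_Ioc h1 h2, measureReal_union _ measurableSet_Ioc measure_Ioc_lt_top.ne
    measure_Ioc_lt_top.ne]
  rw [Set.disjoint_left]; intro x hx hy; exact absurd hx.2 (not_le.2 hy.1)

/-- The mass transported from `(c, ∞)` into `(a, b]`. -/
theorem prod_hit_mem_Ioc (hsing : μ.MutuallySingular ν)
    (hm : Measurable fun p : ℝ × ℝ => hit μ ν p.2 p.1) {c a b : ℝ} (hca : c ≤ a) (hab : a ≤ b) :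
    (μ.prod unif) {p | c < p.1 ∧ (a : EReal) < hit μ ν p.2 p.1 ∧ hit μ ν p.2 p.1 ≤ b} =
      ENNReal.ofReal (ν.real (Ioc a b) + sInf (pathValues μ ν c b) -
        sInf (pathValues μ ν c a)) := by
  set H : ℝ × ℝ → EReal := fun p => hit μ ν p.2 p.1 with hH
  have hleH : ∀ p (x : ℝ), H p ≤ x → p.1 ≤ x := fun p x h =>
    EReal.coe_le_coe_iff.1 ((le_hit μ ν p.2 p.1).trans h)
  have hle : ∀ x : ℝ, MeasurableSet {p | H p ≤ x} := fun x => measurableSet_le hm measurable_const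
  have hlt : ∀ x : ℝ, MeasurableSet {p | (x : EReal) < H p} := fun x =>
    measurableSet_lt measurable_const hm
  have hprod : ∀ x : ℝ, (μ.prod unif) (Ioc c x ×ˢ univ) = μ (Ioc c x) := fun x => by
    rw [Measure.prod_prod, measure_univ, mul_one]
  have hIoc : ∀ x : ℝ, MeasurableSet (Ioc c x ×ˢ univ : Set (ℝ × ℝ)) := fun x =>
    measurableSet_Ioc.prod MeasurableSet.univ
  set M := {p | c < p.1 ∧ (a : EReal) < H p ∧ H p ≤ b} with hM
  -- The mass absorbed up to `a` enters the balances of both `(c, a]` and `(c, b]` and cancels in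
  -- their difference.
  set X := {p | p.1 ∈ Ioc c a ∧ H p ≤ a} with hX
  have hXm : MeasurableSet X := (measurable_fst measurableSet_Ioc).inter (hle a)
  have hMm : MeasurableSet M := (measurable_fst measurableSet_Ioi).inter ((hlt a).inter (hle b))
  have e1 : μ (Ioc c a) = (μ.prod unif) {p | p.1 ∈ Ioc c a ∧ (a : EReal) < H p} +
      (μ.prod unif) X := by
    rw [← hprod, ← measure_union _ hXm]
    · congr 1
      ext p
      simp only [mem_prod, mem_univ, and_true, mem_union, hX, mem_ofPred_eq, ← and_or_left]
      exact ⟨fun h => ⟨h, lt_or_ge _ _⟩, fun h => h.1⟩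
    · rw [Set.disjoint_left]; rintro p ⟨-, h1⟩ ⟨-, h2⟩; exact absurd h1 (not_lt.2 h2)
  have e2 : μ (Ioc c b) = (μ.prod unif) {p | p.1 ∈ Ioc c b ∧ (b : EReal) < H p} +
      ((μ.prod unif) M + (μ.prod unif) X) := by
    rw [← hprod, ← measure_union _ hXm, ← measure_union _ (hMm.union hXm)]
    · congr 1
      ext p
      simp only [mem_prod, mem_univ, and_true, mem_union, hX, hM, mem_ofPred_eq]
      constructor
      · intro h
        rcases lt_or_ge (b : EReal) (H p) with h1 | h1
        · exact Or.inl ⟨h, h1⟩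
        · rcases lt_or_ge (a : EReal) (H p) with h2 | h2
          · exact Or.inr (Or.inl ⟨h.1, h2, h1⟩)
          · exact Or.inr (Or.inr ⟨⟨h.1, hleH p a h2⟩, h2⟩)
      · rintro (h | h | h)
        · exact h.1
        · exact ⟨h.1, hleH p b h.2.2⟩
        · exact ⟨h.1.1, h.1.2.trans hab⟩
    · rw [Set.disjoint_left]
      rintro p ⟨-, h1⟩ (⟨-, -, h2⟩ | ⟨-, h2⟩)
      · exact absurd h1 (not_lt.2 h2)
      · exact absurd h1 (not_lt.2 (h2.trans (EReal.coe_le_coe_iff.2 hab)))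
    · rw [Set.disjoint_left]; rintro p ⟨-, h1, -⟩ ⟨-, h2⟩; exact absurd h1 (not_lt.2 h2)
  rw [hH, prod_lt_hit hsing] at e1 e2
  have hfin : (μ.prod unif) M ≠ ∞ := by
    refine ne_top_of_le_ne_top (measure_Ioc_lt_top (μ := μ) (a := c) (b := b)).ne ?_
    rw [e2]; exact le_add_left (le_add_right le_rfl)
  have hfinX : (μ.prod unif) X ≠ ∞ := by
    refine ne_top_of_le_ne_top (measure_Ioc_lt_top (μ := μ) (a := c) (b := b)).ne ?_
    rw [e2]; exact le_add_left (le_add_left le_rfl)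
  have hval : ∀ x, 0 ≤ μ.real (Ioc c x) - ν.real (Ioc c x) - sInf (pathValues μ ν c x) :=
    fun x => sub_nonneg.2 (csInf_le (bddBelow_pathValues c x) (Or.inr ⟨x, le_rfl, Or.inl rfl⟩))
  have f1 := congrArg ENNReal.toReal e1
  have f2 := congrArg ENNReal.toReal e2
  rw [ENNReal.toReal_add (by finiteness) hfinX, ENNReal.toReal_ofReal (hval _)] at f1
  rw [ENNReal.toReal_add (by finiteness) (by finiteness), ENNReal.toReal_ofReal (hval _),
    ENNReal.toReal_add hfin hfinX] at f2
  rw [← measureReal_def] at f1 f2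
  rw [← ENNReal.ofReal_toReal hfin]
  congr 1
  have := real_Ioc_add ν hca hab
  linarith

/-- The running infimum can only fall when the window grows. -/
theorem prod_hit_mem_Ioc_le (hsing : μ.MutuallySingular ν)
    (hm : Measurable fun p : ℝ × ℝ => hit μ ν p.2 p.1) {c a b : ℝ} (hca : c ≤ a) (hab : a ≤ b) :
    (μ.prod unif) {p | c < p.1 ∧ (a : EReal) < hit μ ν p.2 p.1 ∧ hit μ ν p.2 p.1 ≤ b} ≤
      ν (Ioc a b) := by
  rw [prod_hit_mem_Ioc hsing hm hca hab, ← ofReal_measureReal measure_Ioc_lt_top.ne]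
  refine ENNReal.ofReal_le_ofReal ?_
  have : sInf (pathValues μ ν c b) ≤ sInf (pathValues μ ν c a) := by
    refine csInf_le_csInf (bddBelow_pathValues c b) ⟨0, Or.inl rfl⟩ ?_
    rintro x (h | ⟨t, ht, h⟩)
    · exact Or.inl h
    · exact Or.inr ⟨t, ht.trans hab, h⟩
  linarith

/-- By `hs` the path never drops below its left limit at `s` again, so the running infimum is
already settled at `a`. -/
theorem prod_hit_mem_Ioc_ge (hsing : μ.MutuallySingular ν)
    (hm : Measurable fun p : ℝ × ℝ => hit μ ν p.2 p.1) {c s a b : ℝ} (hcs : c < s) (hsa : s ≤ a)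
    (hab : a ≤ b) (hs : ∀ t, s < t → ν (Icc s t) ≤ μ (Ico s t)) :
    ν (Ioc a b) ≤
    (μ.prod unif) {p | c < p.1 ∧ (a : EReal) < hit μ ν p.2 p.1 ∧ hit μ ν p.2 p.1 ≤ b} := by
  rw [prod_hit_mem_Ioc hsing hm (hcs.le.trans hsa) hab, ← ofReal_measureReal measure_Ioc_lt_top.ne]
  refine ENNReal.ofReal_le_ofReal ?_
  have : sInf (pathValues μ ν c a) ≤ sInf (pathValues μ ν c b) := by
    refine le_csInf ⟨0, Or.inl rfl⟩ ?_
    have hbdd := bddBelow_pathValues (μ := μ) (ν := ν) c a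
    have hbase := csInf_le hbdd (Or.inr ⟨s, hsa, Or.inr rfl⟩)
    have hIcc : ∀ (ρ : Measure ℝ) [IsLocallyFiniteMeasure ρ] (t : ℝ), s < t →
        ρ.real (Ioc c t) = ρ.real (Ioo c s) + ρ.real (Icc s t) := by
      intro ρ _ t ht
      rw [← Ioo_union_Icc_eq_Ioc hcs ht.le, measureReal_union _ measurableSet_Icc
        measure_Ioo_lt_top.ne measure_Icc_lt_top.ne]
      rw [Set.disjoint_left]; intro x hx hy; exact absurd hx.2 (not_lt.2 hy.1)
    have hIco : ∀ (ρ : Measure ℝ) [IsLocallyFiniteMeasure ρ] (t : ℝ), s < t →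
        ρ.real (Ioo c t) = ρ.real (Ioo c s) + ρ.real (Ico s t) := by
      intro ρ _ t ht
      rw [← Ioo_union_Ico_eq_Ioo hcs ht.le, measureReal_union _ measurableSet_Ico
        measure_Ioo_lt_top.ne measure_Ico_lt_top.ne]
      rw [Set.disjoint_left]; intro x hx hy; exact absurd hx.2 (not_lt.2 hy.1)
    have hreal : ∀ t, s < t → ν.real (Icc s t) ≤ μ.real (Ico s t) := fun t ht =>
      ENNReal.toReal_mono measure_Ico_lt_top.ne (hs t ht)
    rintro x (h | ⟨t, -, h⟩)
    · exact csInf_le hbdd (Or.inl h)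
    · rcases le_or_gt t a with ht | ht
      · exact csInf_le hbdd (Or.inr ⟨t, ht, h⟩)
      · have hst := hsa.trans_lt ht
        have h1 := hreal t hst
        have h2 : μ.real (Ico s t) ≤ μ.real (Icc s t) :=
          measureReal_mono Ico_subset_Icc_self measure_Icc_lt_top.ne
        have h3 : ν.real (Ico s t) ≤ ν.real (Icc s t) :=
          measureReal_mono Ico_subset_Icc_self measure_Icc_lt_top.ne
        rcases h with h | h
        · rw [h, hIcc μ t hst, hIcc ν t hst]; linarith
        · rw [h, hIco μ t hst, hIco ν t hst]; linarith
  linarith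
end

/-! ### The measure transported from `μ`, and its domination by `ν`. -/

open Filter Topology in
/-- Domination of measures on the line can be checked on half-open intervals. -/
theorem measure_le_of_Ioc_le {ρ ν : Measure ℝ} [IsLocallyFiniteMeasure ν]
    (h : ∀ a b, a < b → ρ (Ioc a b) ≤ ν (Ioc a b)) : ρ ≤ ν := by
  have hIcc : ∀ a b, a ≤ b → ρ (Icc a b) ≤ ν (Icc a b) := by
    intro a b hab
    refine le_of_forall_gt fun y hy => ?_
    obtain ⟨ε, hε, hlt⟩ := exists_measure_Icc_lt hy
    calc ρ (Icc a b) ≤ ρ (Ioc (a - ε) b) :=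
          measure_mono fun x hx => ⟨by linarith [hx.1], hx.2⟩
      _ ≤ ν (Ioc (a - ε) b) := h _ _ (by linarith)
      _ ≤ ν (Icc (a - ε) (b + ε)) := measure_mono fun x hx => ⟨hx.1.le, by linarith [hx.2]⟩
      _ < y := hlt
  have hfin : IsLocallyFiniteMeasure ρ := by
    refine ⟨fun x => ⟨Icc (x - 1) (x + 1), Icc_mem_nhds (by linarith) (by linarith), ?_⟩⟩
    exact (hIcc _ _ (by linarith)).trans_lt measure_Icc_lt_top
  rw [Measure.le_iff']
  intro s
  -- Closed balls on the line are compact intervals, so the Besicovitch covering theorem extends the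
  -- inequality on intervals to all sets.
  refine (Besicovitch.vitaliFamily ρ).measure_le_of_frequently_le ν
    Measure.AbsolutelyContinuous.rfl s fun x _ => ?_
  refine (Besicovitch.tendsto_filterAt ρ x).frequently (Eventually.frequently ?_)
  filter_upwards [self_mem_nhdsWithin] with r hr
  have hr : 0 < r := hr
  rw [Real.closedBall_eq_Icc]
  exact hIcc _ _ (by linarith)

/-- The measure that the allocation produces from `μ`. -/
noncomputable def hitMeasure (μ ν : Measure ℝ) : Measure ℝ :=
  ((μ.prod unif).restrict {p | hit μ ν p.2 p.1 ≠ ⊤}).map fun p => (hit μ ν p.2 p.1).toReal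

section
variable {μ ν : Measure ℝ}

theorem hitMeasure_apply (hm : Measurable fun p : ℝ × ℝ => hit μ ν p.2 p.1) {B : Set ℝ}
    (hB : MeasurableSet B) : hitMeasure μ ν B =
      (μ.prod unif) {p | ∃ t : ℝ, hit μ ν p.2 p.1 = t ∧ t ∈ B} := by
  have hm' : Measurable fun p : ℝ × ℝ => (hit μ ν p.2 p.1).toReal :=
    measurable_ereal_toReal.comp hm
  have htop : MeasurableSet {p : ℝ × ℝ | hit μ ν p.2 p.1 ≠ ⊤} :=
    (hm (measurableSet_singleton ⊤)).compl
  rw [hitMeasure, Measure.map_apply hm' hB, Measure.restrict_apply (hm' hB)]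
  congr 1
  ext p
  constructor
  · rintro ⟨h1, h2⟩
    exact ⟨_, (EReal.coe_toReal h2 (hit_ne_bot _ _ _ _)).symm, h1⟩
  · rintro ⟨t, h1, h2⟩
    refine ⟨?_, ?_⟩
    · change (hit μ ν p.2 p.1).toReal ∈ B
      rw [h1]; exact h2
    · change hit μ ν p.2 p.1 ≠ ⊤
      rw [h1]; exact EReal.coe_ne_top t

theorem hitMeasure_Ioc (hm : Measurable fun p : ℝ × ℝ => hit μ ν p.2 p.1) (a b : ℝ) :
    hitMeasure μ ν (Ioc a b) =
      (μ.prod unif) {p | (a : EReal) < hit μ ν p.2 p.1 ∧ hit μ ν p.2 p.1 ≤ b} := by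
  rw [hitMeasure_apply hm measurableSet_Ioc]
  congr 1
  ext p
  constructor
  · rintro ⟨t, h1, h2⟩
    change (a : EReal) < hit μ ν p.2 p.1 ∧ hit μ ν p.2 p.1 ≤ b
    rw [h1]
    exact ⟨EReal.coe_lt_coe_iff.2 h2.1, EReal.coe_le_coe_iff.2 h2.2⟩
  · rintro ⟨h1, h2⟩
    have h3 := EReal.coe_toReal (ne_top_of_le_ne_top (EReal.coe_ne_top b) h2) (hit_ne_bot μ ν p.2 p.1)
    rw [← h3] at h1 h2
    exact ⟨_, h3.symm, EReal.coe_lt_coe_iff.1 h1, EReal.coe_le_coe_iff.1 h2⟩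

variable [IsLocallyFiniteMeasure μ] [IsLocallyFiniteMeasure ν]

-- The upper bound for the mass coming from `(c, ∞)` does not depend on `c`; let `c` tend to `-∞`.
open Filter Topology in
theorem hitMeasure_le (hsing : μ.MutuallySingular ν)
    (hm : Measurable fun p : ℝ × ℝ => hit μ ν p.2 p.1) : hitMeasure μ ν ≤ ν := by
  refine measure_le_of_Ioc_le fun a b hab => ?_
  rw [hitMeasure_Ioc hm]
  let S : ℕ → Set (ℝ × ℝ) := fun n =>
    {p | -(n : ℝ) < p.1 ∧ (a : EReal) < hit μ ν p.2 p.1 ∧ hit μ ν p.2 p.1 ≤ b}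
  have hU : {p : ℝ × ℝ | (a : EReal) < hit μ ν p.2 p.1 ∧ hit μ ν p.2 p.1 ≤ b} = ⋃ n, S n := by
    ext p
    simp only [mem_iUnion, S, mem_ofPred_eq]
    constructor
    · intro h
      obtain ⟨n, hn⟩ := exists_nat_gt (-p.1)
      exact ⟨n, by linarith, h⟩
    · rintro ⟨n, -, h⟩; exact h
  have hmono : Monotone S := by
    intro m n hmn p hp
    have : (m : ℝ) ≤ n := by exact_mod_cast hmn
    exact ⟨by linarith [hp.1], hp.2⟩
  rw [hU]
  refine le_of_tendsto (tendsto_measure_iUnion_atTop hmono) ?_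
  obtain ⟨N, hN⟩ := exists_nat_gt (-a)
  filter_upwards [eventually_ge_atTop N] with n hn
  have : (N : ℝ) ≤ n := by exact_mod_cast hn
  exact prod_hit_mem_Ioc_le hsing hm (by linarith) hab.le

/-- For each interval a good point `s` to its left gives the reverse bound, already for mass from
the window starting at `s - 1`; any start before `s` makes the left limit at `s` a path value. -/
theorem hitMeasure_eq (hsing : μ.MutuallySingular ν)
    (hm : Measurable fun p : ℝ × ℝ => hit μ ν p.2 p.1)
    (hs : ∀ c : ℝ, ∃ s ≤ c, ∀ t, s < t → ν (Icc s t) ≤ μ (Ico s t)) : hitMeasure μ ν = ν := by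
  refine (Measure.ext_of_Ioc ν (hitMeasure μ ν) fun a b hab => le_antisymm ?_ ?_).symm
  · obtain ⟨s, hsa, hs⟩ := hs a
    refine (prod_hit_mem_Ioc_ge hsing hm (sub_one_lt s) hsa hab.le hs).trans ?_
    rw [hitMeasure_Ioc hm]
    exact measure_mono fun p hp => hp.2
  · exact hitMeasure_le hsing hm _
end

/-! ### Joint measurability and translation of the hitting time. -/

open Filter Topology in
theorem exists_lt_add_measure_Ioo {μ : Measure ℝ} {s t : ℝ} {h y : ℝ≥0∞}
    (hy : y < h + μ (Ioo s t)) : ∃ δ > 0, y < h + μ (Ioo s (t - δ)) := by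
  have ht : Tendsto (fun n : ℕ => μ (Ioo s (t - 1 / (n + 1)))) atTop
      (𝓝 (μ (⋃ n : ℕ, Ioo s (t - 1 / ((n : ℝ) + 1))))) := by
    refine tendsto_measure_iUnion_atTop fun m n hmn => Ioo_subset_Ioo_right ?_
    have : (1 : ℝ) / (n + 1) ≤ 1 / (m + 1) := by gcongr
    linarith
  have hU : (⋃ n : ℕ, Ioo s (t - 1 / ((n : ℝ) + 1))) = Ioo s t := by
    ext x
    simp only [mem_iUnion, mem_Ioo]
    constructor
    · rintro ⟨n, h1, h2⟩
      have : (0 : ℝ) < 1 / (n + 1) := by positivity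
      exact ⟨h1, by linarith⟩
    · intro h
      obtain ⟨n, hn⟩ := exists_nat_one_div_lt (sub_pos.2 h.2)
      exact ⟨n, h.1, by linarith⟩
  rw [hU] at ht
  obtain ⟨n, hn⟩ := ((ht.const_add h).eventually (lt_mem_nhds hy)).exists
  exact ⟨1 / (n + 1), by positivity, hn⟩

open Filter Topology in
/-- Hitting before `b` can be checked approximately and on rational times. -/
theorem hit_lt_iff {μ ν : Measure ℝ} [IsLocallyFiniteMeasure μ] [IsLocallyFiniteMeasure ν]
    (hsing : μ.MutuallySingular ν) {u s : ℝ} {b : EReal} :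
    hit μ ν u s < b ↔ ∃ p q : ℚ, s < p ∧ ((q : ℝ) : EReal) < b ∧ ∀ n : ℕ, ∃ r : ℚ,
      p ≤ r ∧ r ≤ q ∧ ENNReal.ofReal u * μ {s} + μ (Ioo s (r : ℝ)) ≤
        ν (Icc s (r : ℝ)) + ((n : ℝ≥0∞) + 1)⁻¹ := by
  rw [hit, sInf_lt_iff]
  set h := ENNReal.ofReal u * μ {s}
  constructor
  · rintro ⟨_, ⟨t, ⟨hst, hc⟩, rfl⟩, htb⟩
    obtain ⟨q, h1, h2⟩ := EReal.lt_iff_exists_rat_btwn.1 htb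
    have h1 : t < q := EReal.coe_lt_coe_iff.1 h1
    obtain ⟨p, h3, h4⟩ := exists_rat_btwn hst
    refine ⟨p, q, h3, h2, fun n => ?_⟩
    have hε : (0 : ℝ≥0∞) < ((n : ℝ≥0∞) + 1)⁻¹ := by simp
    -- Singularity decides in which direction `t` is moved to a rational: to the right at little
    -- cost in `μ`, or to the left at little loss in `ν`.
    have hzero : μ {t} = 0 ∨ ν {t} = 0 := by
      by_cases ht : t ∈ hsing.nullSet
      · exact Or.inl (measure_mono_null (singleton_subset_iff.2 ht) hsing.measure_nullSet)
      · exact Or.inr (measure_mono_null (singleton_subset_iff.2 ht) hsing.measure_compl_nullSet)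
    rcases hzero with h0 | h0
    · obtain ⟨δ, hδ, hlt⟩ := exists_measure_Icc_lt (ν := μ) (a := t) (b := t)
        (y := ((n : ℝ≥0∞) + 1)⁻¹) (by rw [Icc_self, h0]; exact hε)
      obtain ⟨r, h5, h6⟩ := exists_rat_btwn (show t < min (q : ℝ) (t + δ) from
        lt_min h1 (by linarith))
      have h7 : (r : ℝ) < q := h6.trans_le (min_le_left _ _)
      have h8 : (r : ℝ) < t + δ := h6.trans_le (min_le_right _ _)
      refine ⟨r, by exact_mod_cast (h4.trans h5).le, by exact_mod_cast h7.le, ?_⟩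
      calc h + μ (Ioo s (r : ℝ)) ≤ h + (μ (Ioo s t) + μ (Icc (t - δ) (t + δ))) := by
            gcongr
            refine (measure_mono fun x hx => ?_).trans (measure_union_le _ _)
            rcases lt_or_ge x t with hxt | hxt
            · exact Or.inl ⟨hx.1, hxt⟩
            · exact Or.inr ⟨by linarith, by linarith [hx.2]⟩
        _ ≤ ν (Icc s t) + ((n : ℝ≥0∞) + 1)⁻¹ := by rw [← add_assoc]; gcongr
        _ ≤ _ := by gcongr
    · obtain ⟨δ, hδ, hlt⟩ := exists_measure_Icc_lt (ν := ν) (a := t) (b := t)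
        (y := ((n : ℝ≥0∞) + 1)⁻¹) (by rw [Icc_self, h0]; exact hε)
      obtain ⟨r, h5, h6⟩ := exists_rat_btwn (show max (p : ℝ) (t - δ) < t from
        max_lt h4 (by linarith))
      have h7 : (p : ℝ) < r := (le_max_left _ _).trans_lt h5
      have h8 : t - δ < r := (le_max_right _ _).trans_lt h5
      refine ⟨r, by exact_mod_cast h7.le, by exact_mod_cast (h6.trans h1).le, ?_⟩
      calc h + μ (Ioo s (r : ℝ)) ≤ h + μ (Ioo s t) := by gcongr
        _ ≤ ν (Icc s t) := hc
        _ ≤ ν (Icc s (r : ℝ)) + ν (Icc (t - δ) (t + δ)) := by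
            refine (measure_mono fun x hx => ?_).trans (measure_union_le _ _)
            rcases le_or_gt x r with hxt | hxt
            · exact Or.inl ⟨hx.1, hxt⟩
            · exact Or.inr ⟨by linarith, by linarith [hx.2]⟩
        _ ≤ _ := by gcongr
  · rintro ⟨p, q, hsp, hqb, happ⟩
    choose r hpr hrq hr using happ
    -- A limit of approximate solutions is a solution, as `μ (Ioo s t)` is lower and `ν (Icc s t)`
    -- upper semicontinuous in `t`. The bound `p > s` keeps the limit away from `s`.
    obtain ⟨t, htm, φ, hφ, hlim⟩ := (isCompact_Icc (a := (p : ℝ)) (b := q)).tendsto_subseq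
      (x := fun n => (r n : ℝ)) fun n => ⟨by exact_mod_cast hpr n, by exact_mod_cast hrq n⟩
    refine ⟨_, ⟨t, ⟨hsp.trans_le htm.1, ?_⟩, rfl⟩, lt_of_le_of_lt (EReal.coe_le_coe_iff.2 htm.2) hqb⟩
    by_contra hn
    obtain ⟨y, hy1, hy2⟩ := exists_between (not_le.1 hn)
    obtain ⟨ε, hε, h1⟩ := exists_measure_Icc_lt hy1
    obtain ⟨δ, hδ, h2⟩ := exists_lt_add_measure_Ioo hy2
    have hinv : Tendsto (fun n : ℕ => ((φ n : ℝ≥0∞) + 1)⁻¹) atTop (𝓝 0) := by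
      have h3 : Tendsto (fun n : ℕ => ((n : ℝ≥0∞) + 1)⁻¹) atTop (𝓝 0) := by
        have := (tendsto_add_atTop_iff_nat 1).2 ENNReal.tendsto_inv_nat_nhds_zero
        simpa using this
      exact h3.comp hφ.tendsto_atTop
    have hle : h + μ (Ioo s (t - δ)) ≤ ν (Icc (s - ε) (t + ε)) + 0 := by
      refine ge_of_tendsto (hinv.const_add _) ?_
      filter_upwards [hlim (Ioo_mem_nhds (show t - δ < t by linarith)
        (show t < t + ε by linarith))] with n hn
      have hn : (r (φ n) : ℝ) ∈ Ioo (t - δ) (t + ε) := hn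
      calc h + μ (Ioo s (t - δ)) ≤ h + μ (Ioo s (r (φ n) : ℝ)) := by
            gcongr; exact hn.1.le
        _ ≤ ν (Icc s (r (φ n) : ℝ)) + ((φ n : ℝ≥0∞) + 1)⁻¹ := hr _
        _ ≤ _ := by
            gcongr
            · linarith
            · exact hn.2.le
    rw [add_zero] at hle
    exact absurd (h2.trans_le hle) (not_lt.2 h1.le)

/-- The allocation is jointly measurable in all its arguments. -/
theorem measurable_hit {Ω : Type*} [MeasurableSpace Ω] (ξ η : Kernel Ω ℝ) [IsSFiniteKernel ξ]
    [IsSFiniteKernel η] (hξ : ∀ ω, IsLocallyFiniteMeasure (ξ ω))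
    (hη : ∀ ω, IsLocallyFiniteMeasure (η ω)) (hsing : ∀ ω, (ξ ω).MutuallySingular (η ω)) :
    Measurable fun q : Ω × ℝ × ℝ => hit (ξ q.1) (η q.1) q.2.2 q.2.1 := by
  refine measurable_of_Iio fun b => ?_
  have : (fun q : Ω × ℝ × ℝ => hit (ξ q.1) (η q.1) q.2.2 q.2.1) ⁻¹' Iio b =
      {q | ∃ p r : ℚ, q.2.1 < (p : ℝ) ∧ ((r : ℝ) : EReal) < b ∧ ∀ n : ℕ, ∃ x : ℚ, p ≤ x ∧ x ≤ r ∧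
        ENNReal.ofReal q.2.2 * ξ q.1 {q.2.1} + ξ q.1 (Ioo q.2.1 (x : ℝ)) ≤
        η q.1 (Icc q.2.1 (x : ℝ)) + ((n : ℝ≥0∞) + 1)⁻¹} := by
    ext q
    have := hξ q.1
    have := hη q.1
    exact hit_lt_iff (hsing q.1)
  rw [this]
  have m1 : Measurable fun q : Ω × ℝ × ℝ => ξ q.1 {q.2.1} := by
    refine Kernel.measurable_kernel_prodMk_left
      (κ := ξ.comap (fun q : Ω × ℝ × ℝ => q.1) measurable_fst)
      (t := {z : (Ω × ℝ × ℝ) × ℝ | z.2 = z.1.2.1}) ?_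
    exact measurableSet_eq_fun (by fun_prop) (by fun_prop)
  have m2 : ∀ x : ℝ, Measurable fun q : Ω × ℝ × ℝ => ξ q.1 (Ioo q.2.1 x) := by
    intro x
    refine Kernel.measurable_kernel_prodMk_left
      (κ := ξ.comap (fun q : Ω × ℝ × ℝ => q.1) measurable_fst)
      (t := {z : (Ω × ℝ × ℝ) × ℝ | z.1.2.1 < z.2 ∧ z.2 < x}) ?_
    have h1 : MeasurableSet {z : (Ω × ℝ × ℝ) × ℝ | z.1.2.1 < z.2} :=
      measurableSet_lt (by fun_prop) (by fun_prop)
    have h2 : MeasurableSet {z : (Ω × ℝ × ℝ) × ℝ | z.2 < x} :=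
      measurableSet_lt (by fun_prop) (by fun_prop)
    exact h1.inter h2
  have m3 : ∀ x : ℝ, Measurable fun q : Ω × ℝ × ℝ => η q.1 (Icc q.2.1 x) := by
    intro x
    refine Kernel.measurable_kernel_prodMk_left
      (κ := η.comap (fun q : Ω × ℝ × ℝ => q.1) measurable_fst)
      (t := {z : (Ω × ℝ × ℝ) × ℝ | z.1.2.1 ≤ z.2 ∧ z.2 ≤ x}) ?_
    have h1 : MeasurableSet {z : (Ω × ℝ × ℝ) × ℝ | z.1.2.1 ≤ z.2} :=
      measurableSet_le (by fun_prop) (by fun_prop)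
    have h2 : MeasurableSet {z : (Ω × ℝ × ℝ) × ℝ | z.2 ≤ x} :=
      measurableSet_le (by fun_prop) (by fun_prop)
    exact h1.inter h2
  refine measurableSet_setOfPred.2 (Measurable.exists fun p => Measurable.exists fun r =>
    Measurable.and ?_ (measurable_const.and (Measurable.forall fun n => Measurable.exists fun x =>
      measurable_const.and (measurable_const.and ?_))))
  · exact measurableSet_setOfPred.1 (measurableSet_lt (by fun_prop) (by fun_prop))
  · refine measurableSet_setOfPred.1 (measurableSet_le ?_ ((m3 x).add measurable_const))
    exact ((ENNReal.measurable_ofReal.comp (by fun_prop)).mul m1).add (m2 x)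

/-- Translation by a real number as an order automorphism of the extended reals. -/
noncomputable def erealAddRight (t : ℝ) : EReal ≃o EReal where
  toFun x := x + t
  invFun x := x - t
  left_inv x := EReal.add_sub_cancel_right
  right_inv x := by simp [EReal.sub_add_cancel]
  map_rel_iff' := by
    intro x y
    refine ⟨fun h => ?_, fun h => add_le_add_left h _⟩
    have h : x + t - t ≤ y + t - t := EReal.sub_le_sub h le_rfl
    rwa [EReal.add_sub_cancel_right, EReal.add_sub_cancel_right] at h

theorem hit_map_sub (μ ν : Measure ℝ) (u s t : ℝ) :
    hit (μ.map (· - t)) (ν.map (· - t)) u s + t = hit μ ν u (s + t) := by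
  have hmeas : Measurable fun x : ℝ => x - t := by fun_prop
  have hset : {r : ℝ | s + t < r ∧ ENNReal.ofReal u * μ {s + t} + μ (Ioo (s + t) r) ≤
      ν (Icc (s + t) r)} = (· + t) '' {r : ℝ | s < r ∧ ENNReal.ofReal u * μ.map (· - t) {s} +
        μ.map (· - t) (Ioo s r) ≤ ν.map (· - t) (Icc s r)} := by
    have h1 : (fun x : ℝ => x - t) ⁻¹' {s} = {s + t} := by
      ext x; simp [sub_eq_iff_eq_add]
    have h2 : ∀ r, (fun x : ℝ => x - t) ⁻¹' Ioo s r = Ioo (s + t) (r + t) := by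
      intro r; ext x; simp
    have h3 : ∀ r, (fun x : ℝ => x - t) ⁻¹' Icc s r = Icc (s + t) (r + t) := by
      intro r; ext x; simp
    ext r
    simp only [mem_ofPred_eq, mem_image, Measure.map_apply hmeas (measurableSet_singleton s),
      Measure.map_apply hmeas measurableSet_Ioo, Measure.map_apply hmeas measurableSet_Icc, h1, h2,
      h3]
    constructor
    · rintro ⟨h4, h5⟩
      exact ⟨r - t, ⟨by linarith, by simpa using h5⟩, by ring⟩
    · rintro ⟨x, ⟨h4, h5⟩, rfl⟩
      exact ⟨by linarith, h5⟩
  have h := (erealAddRight t).map_sInf ((fun r : ℝ => (r : EReal)) '' {r : ℝ | s < r ∧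
    ENNReal.ofReal u * μ.map (· - t) {s} + μ.map (· - t) (Ioo s r) ≤ ν.map (· - t) (Icc s r)})
  rw [hit, hit, hset, image_image]
  refine h.trans ?_
  rw [sInf_eq_iInf, iInf_image, iInf_image]
  rfl

/-- The kernel `ξ` is covariant under the flow, without exceptional set. -/
def IsCovariant {Ω : Type*} [MeasurableSpace Ω] (θ : ℝ → Ω → Ω) (ξ : Kernel Ω ℝ) : Prop :=
  ∀ t ω, ξ (θ t ω) = (ξ ω).map (· - t)

/-! ### Stationarity, mass transport and Palm measures. -/

section
variable {Ω : Type*} [MeasurableSpace Ω] {θ : ℝ → Ω → Ω} {P : Measure Ω}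

theorem IsMeasurableFlow.measurable_apply (hθ : IsMeasurableFlow θ) (s : ℝ) : Measurable (θ s) :=
  hθ.measurable.comp (measurable_id.prodMk measurable_const)

theorem IsMeasurableFlow.image_eq (hθ : IsMeasurableFlow θ) (s : ℝ) (A : Set Ω) :
    θ s '' A = θ (-s) ⁻¹' A := by
  ext ω
  constructor
  · rintro ⟨x, hx, rfl⟩
    rw [mem_preimage, hθ.add, neg_add_cancel, hθ.zero]; exact hx
  · intro h
    exact ⟨θ (-s) ω, h, by rw [hθ.add, add_neg_cancel, hθ.zero]⟩

theorem IsStationaryMeasure.measurePreserving (hθ : IsMeasurableFlow θ)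
    (hP : IsStationaryMeasure θ P) (s : ℝ) : MeasurePreserving (θ s) P P := by
  refine ⟨hθ.measurable_apply s, Measure.ext fun A hA => ?_⟩
  rw [Measure.map_apply (hθ.measurable_apply s) hA]
  have := hP (-s) A hA
  rwa [hθ.image_eq, neg_neg] at this

/-- The mass transport principle on the integers. -/
theorem tsum_lintegral_transport (hθ : IsMeasurableFlow θ) (hP : IsStationaryMeasure θ P)
    {a : ℤ → ℤ → Ω → ℝ≥0∞} (ha : ∀ j k, Measurable (a j k))
    (hcov : ∀ j k r : ℤ, ∀ ω, a j k (θ r ω) = a (j + r) (k + r) ω) :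
    ∑' k, ∫⁻ ω, a 0 k ω ∂P = ∑' j, ∫⁻ ω, a j 0 ω ∂P := by
  rw [← (Equiv.neg ℤ).tsum_eq (fun j => ∫⁻ ω, a j 0 ω ∂P)]
  refine tsum_congr fun k => ?_
  rw [← (hP.measurePreserving hθ ((-k : ℤ) : ℝ)).lintegral_comp (ha 0 k)]
  refine lintegral_congr fun ω => ?_
  rw [hcov]
  simp

section Kernel
variable {ξ : Kernel Ω ℝ} [IsSFiniteKernel ξ]

/-- Stationarity makes the integral independent of `r`; averaged over `r ∈ [0, 1]` it vanishes by
Fubini, because Lebesgue measure has no atoms. Thus `[0, 1]` may be replaced by `[0, 1)`, whose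
integer translates tile the line. -/
theorem lintegral_atom_eq_zero (hθ : IsMeasurableFlow θ) (hP : IsStationaryMeasure θ P) [SFinite P]
    (hξ : IsCovariant θ ξ) (r : ℝ) : ∫⁻ ω, ξ ω {r} ∂P = 0 := by
  have hmeas : Measurable fun q : Ω × ℝ => ξ q.1 {q.2} := by
    refine Kernel.measurable_kernel_prodMk_left
      (κ := ξ.comap (fun q : Ω × ℝ => q.1) measurable_fst)
      (t := {z : (Ω × ℝ) × ℝ | z.2 = z.1.2}) ?_
    exact measurableSet_eq_fun (by fun_prop) (by fun_prop)
  have hconst : ∀ r : ℝ, ∫⁻ ω, ξ ω {r} ∂P = ∫⁻ ω, ξ ω {0} ∂P := by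
    intro r
    rw [← (hP.measurePreserving hθ r).lintegral_comp
      (ξ.measurable_coe (measurableSet_singleton (0 : ℝ)))]
    refine lintegral_congr fun ω => ?_
    rw [hξ, Measure.map_apply (by fun_prop) (measurableSet_singleton 0)]
    congr 1
    ext x; simp [sub_eq_zero]
  have hzero : ∀ ω, ∫⁻ r, ξ ω {r} ∂unif = 0 := by
    intro ω
    have hd : MeasurableSet {p : ℝ × ℝ | p.1 = p.2} := measurableSet_eq_fun (by fun_prop) (by fun_prop)
    have h1 := Measure.prod_apply (μ := unif) (ν := ξ ω) hd
    have h2 := Measure.prod_apply_symm (μ := unif) (ν := ξ ω) hd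
    have e1 : ∀ x : ℝ, Prod.mk x ⁻¹' {p : ℝ × ℝ | p.1 = p.2} = {x} := by
      intro x; ext y; simp [eq_comm]
    have e2 : ∀ y : ℝ, (fun x => (x, y)) ⁻¹' {p : ℝ × ℝ | p.1 = p.2} = {y} := by
      intro x; ext y; simp
    simp only [e1] at h1
    simp only [e2, measure_singleton, lintegral_zero] at h2
    rw [← h1, h2]
  have hsw : ∫⁻ r, ∫⁻ ω, ξ ω {r} ∂P ∂unif = ∫⁻ ω, ∫⁻ r, ξ ω {r} ∂unif ∂P :=
    lintegral_lintegral_swap (hmeas.comp measurable_swap).aemeasurable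
  simp only [hzero, hconst, lintegral_const, measure_univ, mul_one, zero_mul] at hsw
  rw [hconst, hsw]

theorem palmMeasure_eq_Ico (hξfin : ∀ ω, IsLocallyFiniteMeasure (ξ ω))
    (hθ : IsMeasurableFlow θ) (hP : IsStationaryMeasure θ P) [SFinite P]
    (hξ : IsCovariant θ ξ) {A : Set Ω} (hA : MeasurableSet A) :
    palmMeasure θ P ξ A = ∫⁻ ω, ξ ω {s | s ∈ Ico 0 1 ∧ θ s ω ∈ A} ∂P := by
  have hrm : IsRandomMeasure P ξ := Filter.Eventually.of_forall fun ω C hC => by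
    have := hξfin ω
    exact hC.measure_lt_top
  rw [palmMeasure_apply hθ hrm hA]
  have hm : ∀ ω, MeasurableSet {s | θ s ω ∈ A} := fun ω =>
    (hθ.measurable.comp (measurable_const.prodMk measurable_id) : Measurable fun s => θ s ω) hA
  refine lintegral_congr_ae ?_
  have h0 : ∀ᵐ ω ∂P, ξ ω {1} = 0 :=
    (lintegral_eq_zero_iff (ξ.measurable_coe (measurableSet_singleton 1))).1
      (lintegral_atom_eq_zero hθ hP hξ 1)
  filter_upwards [h0] with ω hω
  have : (fun s => A.indicator (1 : Ω → ℝ≥0∞) (θ s ω)) = {s | θ s ω ∈ A}.indicator 1 := rfl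
  rw [this, lintegral_indicator_one (hm ω), Measure.restrict_apply (hm ω)]
  refine le_antisymm ?_ (measure_mono fun s hs => ⟨hs.2, hs.1.1, hs.1.2.le⟩)
  calc ξ ω ({s | θ s ω ∈ A} ∩ Icc 0 1) ≤ ξ ω ({s | s ∈ Ico 0 1 ∧ θ s ω ∈ A} ∪ {1}) := by
        refine measure_mono fun s hs => ?_
        rcases hs.2.2.eq_or_lt with h | h
        · exact Or.inr h
        · exact Or.inl ⟨⟨hs.2.1, h⟩, hs.1⟩
    _ ≤ _ := (measure_union_le _ _).trans (by rw [hω, add_zero])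

theorem measurable_palm_section {F : Set (Ω × ℝ)}
    (hθ : IsMeasurableFlow θ) (hF : MeasurableSet F) :
    Measurable fun q : ℝ × Ω => ξ q.2 {s | s ∈ Ico 0 1 ∧ (θ s q.2, q.1) ∈ F} := by
  refine Kernel.measurable_kernel_prodMk_left
    (κ := ξ.comap (fun q : ℝ × Ω => q.2) measurable_snd)
    (t := {z : (ℝ × Ω) × ℝ | z.2 ∈ Ico 0 1 ∧ (θ z.2 z.1.2, z.1.1) ∈ F}) ?_
  have h1 : Measurable fun z : (ℝ × Ω) × ℝ => (θ z.2 z.1.2, z.1.1) :=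
    (hθ.measurable.comp ((measurable_snd.comp measurable_fst).prodMk measurable_snd)).prodMk
      (measurable_fst.comp measurable_fst)
  exact (measurable_snd measurableSet_Ico).inter (h1 hF)

theorem measurable_palm_slice (hξfin : ∀ ω, IsLocallyFiniteMeasure (ξ ω))
    (hθ : IsMeasurableFlow θ) (hP : IsStationaryMeasure θ P) [SFinite P]
    (hξ : IsCovariant θ ξ) {F : Set (Ω × ℝ)} (hF : MeasurableSet F) :
    Measurable fun u : ℝ => palmMeasure θ P ξ {ω | (ω, u) ∈ F} := by
  have : ∀ u : ℝ, palmMeasure θ P ξ {ω | (ω, u) ∈ F} =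
      ∫⁻ ω, ξ ω {s | s ∈ Ico 0 1 ∧ (θ s ω, u) ∈ F} ∂P := fun u =>
    palmMeasure_eq_Ico hξfin hθ hP hξ (measurable_prodMk_right hF)
  simp only [this]
  exact (measurable_palm_section hθ hF).lintegral_prod_right'

/-- The Palm measure with an independent uniform randomization. -/
theorem lintegral_palm_slice (hξfin : ∀ ω, IsLocallyFiniteMeasure (ξ ω))
    (hθ : IsMeasurableFlow θ) (hP : IsStationaryMeasure θ P) [SFinite P]
    (hξ : IsCovariant θ ξ) {F : Set (Ω × ℝ)} (hF : MeasurableSet F) :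
    ∫⁻ u, palmMeasure θ P ξ {ω | (ω, u) ∈ F} ∂unif =
      ∫⁻ ω, ((ξ ω).prod unif) {p | p.1 ∈ Ico 0 1 ∧ (θ p.1 ω, p.2) ∈ F} ∂P := by
  have : ∀ u : ℝ, palmMeasure θ P ξ {ω | (ω, u) ∈ F} =
      ∫⁻ ω, ξ ω {s | s ∈ Ico 0 1 ∧ (θ s ω, u) ∈ F} ∂P := fun u =>
    palmMeasure_eq_Ico hξfin hθ hP hξ (measurable_prodMk_right hF)
  simp only [this]
  rw [lintegral_lintegral_swap (measurable_palm_section hθ hF).aemeasurable]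
  refine lintegral_congr fun ω => ?_
  rw [Measure.prod_apply_symm]
  · rfl
  · have h1 : Measurable fun p : ℝ × ℝ => (θ p.1 ω, p.2) :=
      (hθ.measurable.comp (measurable_const.prodMk measurable_fst)).prodMk measurable_snd
    exact (measurable_fst measurableSet_Ico).inter (h1 hF)

end Kernel

end

/-! ### The allocation between covariant kernels. -/

section
variable {Ω : Type*} [MeasurableSpace Ω] {θ : ℝ → Ω → Ω} {P : Measure Ω}

/-- Two covariant, locally finite and mutually singular kernels, without exceptional sets. -/
structure IsCovariantPair {Ω : Type*} [MeasurableSpace Ω] (θ : ℝ → Ω → Ω) (ξ η : Kernel Ω ℝ) :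
    Prop where
  left_cov : IsCovariant θ ξ
  right_cov : IsCovariant θ η
  left_fin : ∀ ω, IsLocallyFiniteMeasure (ξ ω)
  right_fin : ∀ ω, IsLocallyFiniteMeasure (η ω)
  sing : ∀ ω, (ξ ω).MutuallySingular (η ω)

namespace IsCovariantPair
variable {ξ η : Kernel Ω ℝ}

theorem hit_flow (h : IsCovariantPair θ ξ η) (t : ℝ) (ω : Ω) (u s : ℝ) :
    hit (ξ (θ t ω)) (η (θ t ω)) u s + t = hit (ξ ω) (η ω) u (s + t) := by
  rw [h.left_cov, h.right_cov, hit_map_sub]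

theorem hit_flow_eq_coe (h : IsCovariantPair θ ξ η) {t : ℝ} {ω : Ω} {u s r : ℝ} :
    hit (ξ (θ t ω)) (η (θ t ω)) u s = r ↔ hit (ξ ω) (η ω) u (s + t) = ((r + t : ℝ) : EReal) := by
  rw [← h.hit_flow, EReal.coe_add]
  exact ((erealAddRight t).injective.eq_iff (b := (r : EReal))).symm

theorem hit_flow_eq_top (h : IsCovariantPair θ ξ η) {t : ℝ} {ω : Ω} {u s : ℝ} :
    hit (ξ (θ t ω)) (η (θ t ω)) u s = ⊤ ↔ hit (ξ ω) (η ω) u (s + t) = ⊤ := by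
  rw [← h.hit_flow]
  constructor
  · intro h; rw [h]; exact EReal.top_add_coe t
  · intro h
    by_contra hne
    have h1 := EReal.coe_toReal hne (hit_ne_bot _ _ _ _)
    rw [← h1, ← EReal.coe_add] at h
    exact EReal.coe_ne_top _ h

variable [IsSFiniteKernel ξ] [IsSFiniteKernel η]

theorem measurable (h : IsCovariantPair θ ξ η) : Measurable fun q : Ω × ℝ × ℝ => hit (ξ q.1) (η q.1) q.2.2 q.2.1 :=
  measurable_hit ξ η h.left_fin h.right_fin h.sing

theorem measurable_section (h : IsCovariantPair θ ξ η) (ω : Ω) : Measurable fun p : ℝ × ℝ => hit (ξ ω) (η ω) p.2 p.1 :=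
  h.measurable.comp (measurable_const.prodMk measurable_id)

theorem measurableSet_target (h : IsCovariantPair θ ξ η) (hθ : IsMeasurableFlow θ) {A : Set Ω} (hA : MeasurableSet A)
    {B : Set ℝ} (hB : MeasurableSet B) :
    MeasurableSet {q : Ω × ℝ × ℝ |
      ∃ t : ℝ, hit (ξ q.1) (η q.1) q.2.2 q.2.1 = t ∧ t ∈ B ∧ θ t q.1 ∈ A} := by
  have hr : Measurable fun q : Ω × ℝ × ℝ => (hit (ξ q.1) (η q.1) q.2.2 q.2.1).toReal :=
    measurable_ereal_toReal.comp h.measurable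
  have h1 : MeasurableSet {q : Ω × ℝ × ℝ | hit (ξ q.1) (η q.1) q.2.2 q.2.1 ≠ ⊤} :=
    (h.measurable (measurableSet_singleton ⊤)).compl
  have h2 : Measurable fun q : Ω × ℝ × ℝ => θ (hit (ξ q.1) (η q.1) q.2.2 q.2.1).toReal q.1 :=
    hθ.measurable.comp (measurable_fst.prodMk hr)
  convert h1.inter ((hr hB).inter (h2 hA)) using 1
  ext q
  constructor
  · rintro ⟨t, h3, h4, h5⟩
    refine ⟨?_, ?_, ?_⟩
    · change hit (ξ q.1) (η q.1) q.2.2 q.2.1 ≠ ⊤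
      rw [h3]; exact EReal.coe_ne_top t
    · change (hit (ξ q.1) (η q.1) q.2.2 q.2.1).toReal ∈ B
      rw [h3]; exact h4
    · change θ (hit (ξ q.1) (η q.1) q.2.2 q.2.1).toReal q.1 ∈ A
      rw [h3]; exact h5
  · rintro ⟨h3, h4, h5⟩
    exact ⟨_, (EReal.coe_toReal h3 (hit_ne_bot _ _ _ _)).symm, h4, h5⟩

/-- The mass transported from `[j, j + 1)` to the points `t` of `[k, k + 1)` with `θ t ω ∈ A` is
jointly covariant. -/
theorem transport_flow (h : IsCovariantPair θ ξ η) (hθ : IsMeasurableFlow θ) {A : Set Ω} (hA : MeasurableSet A) (j k r : ℤ)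
    (ω : Ω) :
    ((ξ (θ r ω)).prod unif) {p | p.1 ∈ Ico (j : ℝ) (j + 1) ∧ ∃ t : ℝ,
      hit (ξ (θ r ω)) (η (θ r ω)) p.2 p.1 = t ∧ t ∈ Ico (k : ℝ) (k + 1) ∧ θ t (θ r ω) ∈ A} =
    ((ξ ω).prod unif) {p | p.1 ∈ Ico ((j + r : ℤ) : ℝ) ((j + r : ℤ) + 1) ∧ ∃ t : ℝ,
      hit (ξ ω) (η ω) p.2 p.1 = t ∧ t ∈ Ico ((k + r : ℤ) : ℝ) ((k + r : ℤ) + 1) ∧ θ t ω ∈ A} := by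
  have hfin := h.left_fin ω
  have hm : Measurable fun s : ℝ => s - (r : ℝ) := by fun_prop
  have hprod : (ξ (θ r ω)).prod unif = ((ξ ω).prod unif).map (Prod.map (· - (r : ℝ)) id) := by
    rw [h.left_cov, ← Measure.map_prod_map _ _ hm measurable_id, Measure.map_id]
  have hmeas : MeasurableSet {p : ℝ × ℝ | p.1 ∈ Ico (j : ℝ) (j + 1) ∧ ∃ t : ℝ,
      hit (ξ (θ r ω)) (η (θ r ω)) p.2 p.1 = t ∧ t ∈ Ico (k : ℝ) (k + 1) ∧ θ t (θ r ω) ∈ A} :=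
    (measurable_fst measurableSet_Ico).inter ((measurable_const.prodMk measurable_id :
      Measurable fun p : ℝ × ℝ => (θ r ω, p)) (h.measurableSet_target hθ hA measurableSet_Ico))
  rw [hprod, Measure.map_apply (hm.prodMap measurable_id) hmeas]
  congr 1
  ext p
  have e1 : p.1 - (r : ℝ) ∈ Ico (j : ℝ) (j + 1) ↔
      p.1 ∈ Ico ((j + r : ℤ) : ℝ) ((j + r : ℤ) + 1) := by
    push_cast
    constructor <;> rintro ⟨h1, h2⟩ <;> constructor <;> linarith
  refine and_congr e1 ?_
  constructor
  · rintro ⟨t, h1, h2, h3⟩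
    rw [h.hit_flow_eq_coe] at h1
    refine ⟨t + r, ?_, ?_, ?_⟩
    · rw [← h1]; simp
    · push_cast
      constructor <;> linarith [h2.1, h2.2]
    · rwa [hθ.add] at h3
  · rintro ⟨t, h1, h2, h3⟩
    refine ⟨t - r, ?_, ?_, ?_⟩
    · rw [h.hit_flow_eq_coe]
      simpa using h1
    · push_cast at h2
      constructor <;> linarith [h2.1, h2.2]
    · rw [hθ.add, sub_add_cancel]; exact h3

/-- The randomized Palm measure of `ξ`, shifted by the allocation, is the Palm measure of the
transported measure. -/
theorem lintegral_palm_shiftEvent (h : IsCovariantPair θ ξ η) (hθ : IsMeasurableFlow θ) (hP : IsStationaryMeasure θ P)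
    [SFinite P] {A : Set Ω} (hA : MeasurableSet A) :
    ∫⁻ u, palmMeasure θ P ξ (shiftEvent θ (fun ω => hit (ξ ω) (η ω) u 0) A) ∂unif =
      ∫⁻ ω, hitMeasure (ξ ω) (η ω) {t | t ∈ Ico 0 1 ∧ θ t ω ∈ A} ∂P := by
  -- The mass that block `j` sends into block `k`, counted where the target sees `A`. Summing over
  -- targets of block `0` gives the shifted Palm measure, summing over its sources the transported
  -- measure on `[0, 1)`.
  let a : ℤ → ℤ → Ω → ℝ≥0∞ := fun j k ω =>
    ((ξ ω).prod unif) {p | p.1 ∈ Ico (j : ℝ) (j + 1) ∧ ∃ t : ℝ,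
      hit (ξ ω) (η ω) p.2 p.1 = t ∧ t ∈ Ico (k : ℝ) (k + 1) ∧ θ t ω ∈ A}
  have hset : ∀ j k : ℤ, MeasurableSet {q : Ω × ℝ × ℝ | q.2.1 ∈ Ico (j : ℝ) (j + 1) ∧
      ∃ t : ℝ, hit (ξ q.1) (η q.1) q.2.2 q.2.1 = t ∧ t ∈ Ico (k : ℝ) (k + 1) ∧ θ t q.1 ∈ A} :=
    fun j k => ((measurable_fst.comp measurable_snd) measurableSet_Ico).inter
      (h.measurableSet_target hθ hA measurableSet_Ico)
  have hsec : ∀ j k : ℤ, ∀ ω, MeasurableSet {p : ℝ × ℝ | p.1 ∈ Ico (j : ℝ) (j + 1) ∧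
      ∃ t : ℝ, hit (ξ ω) (η ω) p.2 p.1 = t ∧ t ∈ Ico (k : ℝ) (k + 1) ∧ θ t ω ∈ A} :=
    fun j k ω => measurable_prodMk_left (hset j k)
  have ha : ∀ j k, Measurable (a j k) := by
    intro j k
    have h1 := Kernel.measurable_kernel_prodMk_left (κ := ξ ×ₖ Kernel.const Ω unif) (hset j k)
    simp only [Kernel.prod_apply, Kernel.const_apply] at h1
    exact h1
  have htr := tsum_lintegral_transport hθ hP ha fun j k r ω => h.transport_flow hθ hA j k r ω
  have hF : MeasurableSet {q : Ω × ℝ | ∃ t : ℝ, hit (ξ q.1) (η q.1) q.2 0 = t ∧ t ∈ univ ∧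
      θ t q.1 ∈ A} :=
    (measurable_fst.prodMk (measurable_const.prodMk measurable_snd) :
      Measurable fun q : Ω × ℝ => (q.1, (0 : ℝ), q.2))
      (h.measurableSet_target hθ hA MeasurableSet.univ)
  have hL : ∀ u, shiftEvent θ (fun ω => hit (ξ ω) (η ω) u 0) A = {ω | (ω, u) ∈
      {q : Ω × ℝ | ∃ t : ℝ, hit (ξ q.1) (η q.1) q.2 0 = t ∧ t ∈ univ ∧ θ t q.1 ∈ A}} := by
    intro u; ext ω; simp [shiftEvent]
  simp only [hL]
  rw [lintegral_palm_slice h.left_fin hθ hP h.left_cov hF]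
  have hleft : ∀ ω, ((ξ ω).prod unif) {p | p.1 ∈ Ico 0 1 ∧ (θ p.1 ω, p.2) ∈
      {q : Ω × ℝ | ∃ t : ℝ, hit (ξ q.1) (η q.1) q.2 0 = t ∧ t ∈ univ ∧ θ t q.1 ∈ A}} =
      ∑' k, a 0 k ω := by
    intro ω
    rw [← measure_iUnion _ fun k => hsec 0 k ω]
    · congr 1
      ext p
      simp only [mem_iUnion, mem_ofPred_eq, mem_univ, true_and, Int.cast_zero, zero_add,
        exists_and_left]
      refine and_congr_right fun _ => ?_
      constructor
      · rintro ⟨t, h1, h2⟩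
        rw [h.hit_flow_eq_coe, zero_add] at h1
        refine ⟨⌊t + p.1⌋, t + p.1, h1, ⟨Int.floor_le _, Int.lt_floor_add_one _⟩, ?_⟩
        rwa [hθ.add] at h2
      · rintro ⟨k, t, h1, -, h2⟩
        refine ⟨t - p.1, ?_, ?_⟩
        · rw [h.hit_flow_eq_coe]; simpa using h1
        · rwa [hθ.add, sub_add_cancel]
    · intro k l hkl
      rw [Function.onFun, Set.disjoint_left]
      rintro p ⟨-, t, h1, h2, -⟩ ⟨-, t', h1', h2', -⟩
      rw [h1, EReal.coe_eq_coe_iff] at h1'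
      subst h1'
      exact hkl ((Int.floor_eq_iff.2 h2).symm.trans (Int.floor_eq_iff.2 h2'))
  have hright : ∀ ω, hitMeasure (ξ ω) (η ω) {t | t ∈ Ico 0 1 ∧ θ t ω ∈ A} = ∑' j, a j 0 ω := by
    intro ω
    have hm : MeasurableSet {t | t ∈ Ico (0 : ℝ) 1 ∧ θ t ω ∈ A} :=
      measurableSet_Ico.inter ((hθ.measurable.comp (measurable_const.prodMk measurable_id) :
        Measurable fun t => θ t ω) hA)
    rw [hitMeasure_apply (h.measurable_section ω) hm, ← measure_iUnion _ fun j => hsec j 0 ω]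
    · congr 1
      ext p
      simp only [mem_iUnion, mem_ofPred_eq, Int.cast_zero, zero_add, exists_and_right]
      exact ⟨fun h => ⟨⟨⌊p.1⌋, Int.floor_le _, Int.lt_floor_add_one _⟩, h⟩, fun h => h.2⟩
    · intro k l hkl
      rw [Function.onFun, Set.disjoint_left]
      rintro p ⟨h2, -⟩ ⟨h2', -⟩
      exact hkl ((Int.floor_eq_iff.2 h2).symm.trans (Int.floor_eq_iff.2 h2'))
  simp only [hleft, hright]
  rw [lintegral_tsum fun k => (ha 0 k).aemeasurable,
    lintegral_tsum fun j => (ha j 0).aemeasurable, htr]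

end IsCovariantPair

end

/-! ### The unmatched mass has no beginning. -/

/-- The part of `μ` that is never absorbed by `ν`. -/
noncomputable def unmatched (μ ν : Measure ℝ) : Measure ℝ :=
  ((μ.prod unif).restrict {p | hit μ ν p.2 p.1 = ⊤}).map Prod.fst

theorem unmatched_apply {μ ν : Measure ℝ} {B : Set ℝ}
    (hB : MeasurableSet B) :
    unmatched μ ν B = (μ.prod unif) {p | p.1 ∈ B ∧ hit μ ν p.2 p.1 = ⊤} := by
  rw [unmatched, Measure.map_apply measurable_fst hB, Measure.restrict_apply (measurable_fst hB)]
  rfl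

/-- An unabsorbed `(s, u)` has `ν[s, t] < u μ{s} + μ(s, t) ≤ μ[s, t)` for all `t > s`, since `u ≤
1`. So `s` is a point as required by `hitMeasure_eq`. -/
theorem hitMeasure_eq_of_unmatched {μ ν : Measure ℝ} [IsLocallyFiniteMeasure μ]
    [IsLocallyFiniteMeasure ν] (hsing : μ.MutuallySingular ν)
    (hm : Measurable fun p : ℝ × ℝ => hit μ ν p.2 p.1)
    (h : ∀ k : ℤ, unmatched μ ν (Iio (k : ℝ)) ≠ 0) : hitMeasure μ ν = ν := by
  refine hitMeasure_eq hsing hm fun c => ?_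
  have h1 := h ⌊c⌋
  rw [unmatched_apply measurableSet_Iio] at h1
  have h2 := (Measure.quasiMeasurePreserving_snd (μ := μ) (ν := unif)).ae ae_unif_mem
  obtain ⟨p, ⟨h3, h4⟩, h5⟩ : ∃ p ∈ {p : ℝ × ℝ | p.1 ∈ Iio (⌊c⌋ : ℝ) ∧ hit μ ν p.2 p.1 = ⊤},
      p.2 ∈ Ioo (0 : ℝ) 1 := by
    by_contra hn
    push Not at hn
    exact h1 (measure_mono_null hn h2)
  have h3 : p.1 < ⌊c⌋ := h3
  refine ⟨p.1, h3.le.trans (Int.floor_le c), fun t ht => ?_⟩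
  have h6 := (hit_eq_top_iff μ ν p.2 p.1).1 h4 t ht
  calc ν (Icc p.1 t) ≤ ENNReal.ofReal p.2 * μ {p.1} + μ (Ioo p.1 t) := h6.le
    _ ≤ 1 * μ {p.1} + μ (Ioo p.1 t) := by
        gcongr
        exact ENNReal.ofReal_le_one.2 h5.2.le
    _ = μ (Ico p.1 t) := by
        rw [one_mul, ← Ioo_union_left ht, union_comm, measure_union (by simp) measurableSet_Ioo]

section
variable {Ω : Type*} [MeasurableSpace Ω] {θ : ℝ → Ω → Ω} {P : Measure Ω}

theorem palmMeasure_univ {ξ : Kernel Ω ℝ} (hθ : IsMeasurableFlow θ) (hξ : IsRandomMeasure P ξ) :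
    palmMeasure θ P ξ univ = intensity P ξ := by
  rw [palmMeasure_apply hθ hξ MeasurableSet.univ, intensity]
  simp

namespace IsCovariantPair
variable {ξ η : Kernel Ω ℝ}

theorem isRandomMeasure_left (h : IsCovariantPair θ ξ η) : IsRandomMeasure P ξ :=
  Filter.Eventually.of_forall fun ω _ hC => by
    have := h.left_fin ω
    exact hC.measure_lt_top

theorem isRandomMeasure_right (h : IsCovariantPair θ ξ η) : IsRandomMeasure P η :=
  Filter.Eventually.of_forall fun ω _ hC => by
    have := h.right_fin ω
    exact hC.measure_lt_top

variable [IsSFiniteKernel ξ] [IsSFiniteKernel η]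

theorem measurable_unmatched (h : IsCovariantPair θ ξ η) {B : Set ℝ} (hB : MeasurableSet B) :
    Measurable fun ω => unmatched (ξ ω) (η ω) B := by
  have h1 : MeasurableSet {q : Ω × ℝ × ℝ | q.2.1 ∈ B ∧ hit (ξ q.1) (η q.1) q.2.2 q.2.1 = ⊤} :=
    ((measurable_fst.comp measurable_snd) hB).inter (h.measurable (measurableSet_singleton ⊤))
  have h2 := Kernel.measurable_kernel_prodMk_left (κ := ξ ×ₖ Kernel.const Ω unif) h1
  simp only [Kernel.prod_apply, Kernel.const_apply] at h2
  convert h2 using 2 with ω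
  exact unmatched_apply hB

theorem unmatched_flow (h : IsCovariantPair θ ξ η) (t : ℝ) (ω : Ω) {B : Set ℝ}
    (hB : MeasurableSet B) :
    unmatched (ξ (θ t ω)) (η (θ t ω)) B = unmatched (ξ ω) (η ω) ((· - t) ⁻¹' B) := by
  have hfin := h.left_fin ω
  have hm : Measurable fun s : ℝ => s - t := by fun_prop
  have hprod : (ξ (θ t ω)).prod unif = ((ξ ω).prod unif).map (Prod.map (· - t) id) := by
    rw [h.left_cov, ← Measure.map_prod_map _ _ hm measurable_id, Measure.map_id]
  rw [unmatched_apply hB,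
    unmatched_apply (hm hB), hprod, Measure.map_apply
      (hm.prodMap measurable_id)]
  · congr 1
    ext p
    refine and_congr Iff.rfl ?_
    change hit _ _ p.2 (p.1 - t) = ⊤ ↔ _
    rw [h.hit_flow_eq_top, sub_add_cancel]
  · exact (measurable_fst hB).inter ((h.measurable_section _) (measurableSet_singleton ⊤))

/-- The unmatched part of `ξ` almost never has a first point. -/
theorem ae_unmatched_Iio (h : IsCovariantPair θ ξ η) (hθ : IsMeasurableFlow θ)
    (hP : IsStationaryMeasure θ P) (hfin : intensity P ξ < ∞)
    (htot : ∀ᵐ ω ∂P, ξ ω univ = 0 ∨ ξ ω univ = ∞) :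
    ∀ᵐ ω ∂P, unmatched (ξ ω) (η ω) univ ≠ 0 →
      ∀ k : ℤ, unmatched (ξ ω) (η ω) (Iio (k : ℝ)) ≠ 0 := by
  -- The event that the unmatched mass begins in block `k`; at most one `k` qualifies.
  let B : ℤ → Set Ω := fun k => {ω | unmatched (ξ ω) (η ω) (Iio (k : ℝ)) = 0 ∧
    unmatched (ξ ω) (η ω) (Iio ((k : ℝ) + 1)) ≠ 0}
  have hBm : ∀ k, MeasurableSet (B k) := fun k =>
    (h.measurable_unmatched measurableSet_Iio (measurableSet_singleton 0)).inter
      (h.measurable_unmatched measurableSet_Iio (measurableSet_singleton 0)).compl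
  have hBflow : ∀ k r : ℤ, ∀ ω, θ r ω ∈ B k ↔ ω ∈ B (k + r) := by
    intro k r ω
    change (_ ∧ _) ↔ (_ ∧ _)
    have e1 : (fun s : ℝ => s - (r : ℝ)) ⁻¹' Iio (k : ℝ) = Iio ((k + r : ℤ) : ℝ) := by
      ext s; push_cast; simp
    have e2 : (fun s : ℝ => s - (r : ℝ)) ⁻¹' Iio ((k : ℝ) + 1) = Iio (((k + r : ℤ) : ℝ) + 1) := by
      ext s
      push_cast
      simp only [mem_preimage, mem_Iio]
      constructor <;> intro hh <;> linarith
    rw [h.unmatched_flow _ _ measurableSet_Iio, h.unmatched_flow _ _ measurableSet_Iio, e1, e2]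
  -- Every block sends all its `ξ`-mass to the block where the unmatched mass begins. Block `0`
  -- sends at most the intensity on average, but on `B 0` it receives `ξ(ℝ) = ∞`.
  let a : ℤ → ℤ → Ω → ℝ≥0∞ := fun j k => (B k).indicator fun ω => ξ ω (Ico (j : ℝ) (j + 1))
  have ha : ∀ j k, Measurable (a j k) := fun j k =>
    (ξ.measurable_coe measurableSet_Ico).indicator (hBm k)
  have hcov : ∀ j k r : ℤ, ∀ ω, a j k (θ r ω) = a (j + r) (k + r) ω := by
    intro j k r ω
    have e : ξ (θ r ω) (Ico (j : ℝ) (j + 1)) =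
        ξ ω (Ico ((j + r : ℤ) : ℝ) ((j + r : ℤ) + 1)) := by
      rw [h.left_cov, Measure.map_apply (by fun_prop) measurableSet_Ico]
      congr 1
      ext s
      push_cast
      simp only [mem_preimage, mem_Ico]
      constructor <;> rintro ⟨h1, h2⟩ <;> constructor <;> linarith
    simp only [a]
    by_cases hb : θ r ω ∈ B k
    · rw [indicator_of_mem hb, indicator_of_mem ((hBflow k r ω).1 hb), e]
    · rw [indicator_of_notMem hb, indicator_of_notMem (fun hb' => hb ((hBflow k r ω).2 hb'))]
  have htr := tsum_lintegral_transport hθ hP ha hcov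
  have hdisj : ∀ k l : ℤ, k < l → Disjoint (B k) (B l) := by
    intro k l hkl
    rw [Set.disjoint_left]
    rintro ω ⟨-, h1⟩ ⟨h2, -⟩
    refine h1 (measure_mono_null (Iio_subset_Iio ?_) h2)
    exact_mod_cast hkl
  have hdisj' : Pairwise (Function.onFun Disjoint B) := by
    intro k l hkl
    rcases lt_or_gt_of_ne hkl with h1 | h1
    · exact hdisj k l h1
    · exact (hdisj l k h1).symm
  have hleft : ∑' k, ∫⁻ ω, a 0 k ω ∂P ≤ intensity P ξ := by
    have : ∀ k, ∫⁻ ω, a 0 k ω ∂P = ∫⁻ ω in B k, ξ ω (Ico ((0 : ℤ) : ℝ) ((0 : ℤ) + 1)) ∂P :=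
      fun k => lintegral_indicator (hBm k) _
    simp only [this]
    rw [← lintegral_iUnion hBm hdisj']
    refine (setLIntegral_le_lintegral _ _).trans (lintegral_mono fun ω => measure_mono ?_)
    simp only [Int.cast_zero, zero_add]
    exact Ico_subset_Icc_self
  have hright : ∑' j, ∫⁻ ω, a j 0 ω ∂P = ∫⁻ ω in B 0, ξ ω univ ∂P := by
    rw [← lintegral_tsum fun j => (ha j 0).aemeasurable, ← lintegral_indicator (hBm 0)]
    refine lintegral_congr fun ω => ?_
    by_cases hb : ω ∈ B 0
    · simp only [a, indicator_of_mem hb]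
      have hU : (⋃ j : ℤ, Ico (j : ℝ) (j + 1)) = univ := by
        ext x
        simp only [mem_iUnion, mem_univ, iff_true]
        exact ⟨⌊x⌋, Int.floor_le x, Int.lt_floor_add_one x⟩
      rw [← hU, measure_iUnion _ fun j => measurableSet_Ico]
      intro k l hkl
      rw [Function.onFun, Set.disjoint_left]
      intro x h1 h2
      exact hkl ((Int.floor_eq_iff.2 h1).symm.trans (Int.floor_eq_iff.2 h2))
    · simp only [a, indicator_of_notMem hb, tsum_zero]
  have hinf : ∫⁻ ω in B 0, ξ ω univ ∂P = ∫⁻ ω in B 0, ∞ ∂P := by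
    refine setLIntegral_congr_fun_ae (hBm 0) ?_
    filter_upwards [htot] with ω hω hb
    refine hω.resolve_left fun h0 => hb.2 ?_
    rw [unmatched_apply measurableSet_Iio]
    have : ξ ω = 0 := Measure.measure_univ_eq_zero.1 h0
    simp [this]
  have hB0 : P (B 0) = 0 := by
    by_contra hne
    rw [hright, hinf, setLIntegral_const, ENNReal.top_mul hne] at htr
    rw [htr] at hleft
    exact absurd hfin (not_lt.2 hleft)
  have hBk : ∀ k, P (B k) = 0 := by
    intro k
    rw [← (hP.measurePreserving hθ ((-k : ℤ) : ℝ)).measure_preimage (hBm k).nullMeasurableSet]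
    convert hB0 using 2
    ext ω
    rw [mem_preimage, hBflow, add_neg_cancel]
  have hall : ∀ᵐ ω ∂P, ∀ k, ω ∉ B k := ae_all_iff.2 fun k => measure_eq_zero_iff_ae_notMem.1 (hBk k)
  filter_upwards [hall] with ω hω hne k hk
  -- If no block is the first, absence of unmatched mass below `k` propagates to the right over the
  -- whole line.
  have hind : ∀ n : ℕ, unmatched (ξ ω) (η ω) (Iio ((k : ℝ) + n)) = 0 := by
    intro n
    induction n with
    | zero => simpa using hk
    | succ n ih =>
      by_contra hcon
      refine hω (k + n) ⟨?_, ?_⟩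
      · push_cast; exact ih
      · push_cast at hcon ⊢; rwa [add_assoc]
  refine hne ?_
  have hU : (univ : Set ℝ) = ⋃ n : ℕ, Iio ((k : ℝ) + n) := by
    ext x
    simp only [mem_univ, mem_iUnion, mem_Iio, true_iff]
    obtain ⟨n, hn⟩ := exists_nat_gt (x - k)
    exact ⟨n, by linarith⟩
  rw [hU]
  exact measure_iUnion_null hind

end IsCovariantPair

end

/-! ### The ergodic dichotomy and the balancing property. -/

section
variable {Ω : Type*} [MeasurableSpace Ω] {θ : ℝ → Ω → Ω} {P : Measure Ω}

/-- The distribution of the randomized allocation seen from the hit point, under the Palm measure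
of `ξ`. -/
noncomputable def palmShift {Ω : Type*} [MeasurableSpace Ω] (θ : ℝ → Ω → Ω) (P : Measure Ω)
    (ξ η : Kernel Ω ℝ) (A : Set Ω) : ℝ≥0∞ :=
  ∫⁻ u, palmMeasure θ P ξ (shiftEvent θ (fun ω => hit (ξ ω) (η ω) u 0) A) ∂unif

theorem shiftEvent_hit_univ {ξ η : Kernel Ω ℝ} (u : ℝ) : shiftEvent θ (fun ω => hit (ξ ω) (η ω) u 0) univ =
    {ω | hit (ξ ω) (η ω) u 0 = ⊤}ᶜ := by
  ext ω
  constructor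
  · rintro ⟨t, h1, -⟩ h2
    have h1 : hit (ξ ω) (η ω) u 0 = t := h1
    have h2 : hit (ξ ω) (η ω) u 0 = ⊤ := h2
    rw [h1] at h2
    exact EReal.coe_ne_top t h2
  · intro h1
    exact ⟨_, (EReal.coe_toReal h1 (hit_ne_bot _ _ _ _)).symm, trivial⟩

namespace IsCovariantPair
variable {ξ η : Kernel Ω ℝ} [IsSFiniteKernel ξ] [IsSFiniteKernel η]

theorem measurableSet_shiftEvent (h : IsCovariantPair θ ξ η) (hθ : IsMeasurableFlow θ) {A : Set Ω}
    (hA : MeasurableSet A) :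
    MeasurableSet {q : Ω × ℝ | q.1 ∈ shiftEvent θ (fun ω => hit (ξ ω) (η ω) q.2 0) A} := by
  have h1 : Measurable fun q : Ω × ℝ => (q.1, (0 : ℝ), q.2) :=
    measurable_fst.prodMk (measurable_const.prodMk measurable_snd)
  convert h1 (h.measurableSet_target hθ hA MeasurableSet.univ) using 1
  ext q
  simp [shiftEvent]

theorem measurableSet_hit_eq_top (h : IsCovariantPair θ ξ η) :
    MeasurableSet {q : Ω × ℝ | hit (ξ q.1) (η q.1) q.2 0 = ⊤} := by
  have h1 : Measurable fun q : Ω × ℝ => (q.1, (0 : ℝ), q.2) :=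
    measurable_fst.prodMk (measurable_const.prodMk measurable_snd)
  exact h1 (h.measurable (measurableSet_singleton ⊤))

theorem measurable_palm_hit_eq_top (h : IsCovariantPair θ ξ η) (hθ : IsMeasurableFlow θ)
    (hP : IsStationaryMeasure θ P) [SFinite P] :
    Measurable fun u : ℝ => palmMeasure θ P ξ {ω | hit (ξ ω) (η ω) u 0 = ⊤} := by
  have := measurable_palm_slice h.left_fin hθ hP h.left_cov h.measurableSet_hit_eq_top
  simpa only [mem_ofPred_eq] using this

theorem lintegral_palm_hit_eq_top (h : IsCovariantPair θ ξ η) (hθ : IsMeasurableFlow θ)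
    (hP : IsStationaryMeasure θ P) [SFinite P] :
    ∫⁻ u, palmMeasure θ P ξ {ω | hit (ξ ω) (η ω) u 0 = ⊤} ∂unif =
      ∫⁻ ω, unmatched (ξ ω) (η ω) (Ico 0 1) ∂P := by
  have hs := lintegral_palm_slice h.left_fin hθ hP h.left_cov h.measurableSet_hit_eq_top
  simp only [mem_ofPred_eq] at hs
  refine hs.trans (lintegral_congr fun ω => ?_)
  rw [unmatched_apply measurableSet_Ico]
  congr 1
  ext p
  refine and_congr Iff.rfl ?_
  rw [h.hit_flow_eq_top, zero_add]

theorem palmShift_univ_add (h : IsCovariantPair θ ξ η) (hθ : IsMeasurableFlow θ)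
    (hP : IsStationaryMeasure θ P) [SFinite P] :
    palmShift θ P ξ η univ + ∫⁻ u, palmMeasure θ P ξ {ω | hit (ξ ω) (η ω) u 0 = ⊤} ∂unif =
      intensity P ξ := by
  rw [palmShift, ← lintegral_add_right _ (h.measurable_palm_hit_eq_top hθ hP),
    ← palmMeasure_univ hθ h.isRandomMeasure_left]
  have : ∀ u, palmMeasure θ P ξ (shiftEvent θ (fun ω => hit (ξ ω) (η ω) u 0) univ) +
      palmMeasure θ P ξ {ω | hit (ξ ω) (η ω) u 0 = ⊤} = palmMeasure θ P ξ univ := by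
    intro u
    have hm : MeasurableSet {ω | hit (ξ ω) (η ω) u 0 = ⊤} :=
      measurable_prodMk_right h.measurableSet_hit_eq_top
    rw [shiftEvent_hit_univ, add_comm, measure_add_measure_compl hm]
  simp only [this, lintegral_const, measure_univ, mul_one]

theorem palmShift_univ_le (h : IsCovariantPair θ ξ η) (hθ : IsMeasurableFlow θ)
    (hP : IsStationaryMeasure θ P) [SFinite P] {A : Set Ω} (hA : MeasurableSet A) :
    palmShift θ P ξ η univ ≤ palmShift θ P ξ η A + palmShift θ P ξ η Aᶜ := by
  have hm : Measurable fun u : ℝ =>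
      palmMeasure θ P ξ (shiftEvent θ (fun ω => hit (ξ ω) (η ω) u 0) A) := by
    have := measurable_palm_slice h.left_fin hθ hP h.left_cov (h.measurableSet_shiftEvent hθ hA)
    simpa only [mem_ofPred_eq, ofPred_mem_eq] using this
  rw [palmShift, palmShift, palmShift, ← lintegral_add_left hm]
  refine lintegral_mono fun u => (measure_mono ?_).trans (measure_union_le _ _)
  rintro ω ⟨t, h1, -⟩
  by_cases hta : θ t ω ∈ A
  · exact Or.inl ⟨t, h1, hta⟩
  · exact Or.inr ⟨t, h1, hta⟩

/-- Mass transport turns this into the pathwise bound `hitMeasure_le`. -/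
theorem palmShift_le (h : IsCovariantPair θ ξ η) (hθ : IsMeasurableFlow θ)
    (hP : IsStationaryMeasure θ P) [SFinite P] {A : Set Ω} (hA : MeasurableSet A) :
    palmShift θ P ξ η A ≤ palmMeasure θ P η A := by
  rw [palmShift, h.lintegral_palm_shiftEvent hθ hP hA,
    palmMeasure_eq_Ico h.right_fin hθ hP h.right_cov hA]
  refine lintegral_mono fun ω => ?_
  have := h.left_fin ω
  have := h.right_fin ω
  exact hitMeasure_le (h.sing ω) (h.measurable_section ω) _

/-- The balancing property of the allocation for covariant kernels. -/
theorem palm_balance (h : IsCovariantPair θ ξ η) (hθ : IsMeasurableFlow θ)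
    (hP : IsStationaryMeasure θ P) [SFinite P] (herg : IsErgodicFlow θ P)
    (hint : intensity P ξ = intensity P η) (hfin : intensity P ξ < ∞)
    (htot : ∀ᵐ ω ∂P, ξ ω univ = 0 ∨ ξ ω univ = ∞) :
    (∀ᵐ u ∂unif, palmMeasure θ P ξ {ω | hit (ξ ω) (η ω) u 0 = ⊤} = 0) ∧
    ∀ A, MeasurableSet A → palmShift θ P ξ η A = palmMeasure θ P η A := by
  have hsum := h.palmShift_univ_add hθ hP
  have hηuniv : palmMeasure θ P η univ = intensity P ξ := by
    rw [palmMeasure_univ hθ h.isRandomMeasure_right, hint]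
  have hgood := h.ae_unmatched_Iio hθ hP hfin htot
  have hA0m : MeasurableSet {ω | unmatched (ξ ω) (η ω) univ ≠ 0} :=
    (h.measurable_unmatched MeasurableSet.univ (measurableSet_singleton 0)).compl
  have hA0inv : ∀ s : ℝ, θ s '' {ω | unmatched (ξ ω) (η ω) univ ≠ 0} =
      {ω | unmatched (ξ ω) (η ω) univ ≠ 0} := by
    intro s
    rw [hθ.image_eq]
    ext ω
    change unmatched (ξ (θ (-s) ω)) (η (θ (-s) ω)) univ ≠ 0 ↔ _
    rw [h.unmatched_flow _ _ MeasurableSet.univ, preimage_univ]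
    rfl
  suffices hconcl : ∫⁻ u, palmMeasure θ P ξ {ω | hit (ξ ω) (η ω) u 0 = ⊤} ∂unif = 0 ∧
      ∀ A, MeasurableSet A → palmShift θ P ξ η A = palmMeasure θ P η A from
    ⟨(lintegral_eq_zero_iff (h.measurable_palm_hit_eq_top hθ hP)).1 hconcl.1, hconcl.2⟩
  rcases herg _ hA0m hA0inv with h0 | h0
  -- No mass is lost here, so `palmShift` has the total mass of `P_η`. A strict inequality on `A`
  -- could not be made up on `Aᶜ`.
  · have hU0 : ∫⁻ u, palmMeasure θ P ξ {ω | hit (ξ ω) (η ω) u 0 = ⊤} ∂unif = 0 := by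
      rw [h.lintegral_palm_hit_eq_top hθ hP,
        lintegral_eq_zero_iff (h.measurable_unmatched measurableSet_Ico)]
      filter_upwards [measure_eq_zero_iff_ae_notMem.1 h0] with ω hω
      exact measure_mono_null (subset_univ _) (not_not.1 hω)
    refine ⟨hU0, fun A hA => ?_⟩
    rw [hU0, add_zero] at hsum
    refine le_antisymm (h.palmShift_le hθ hP hA) ?_
    have hfinc : palmMeasure θ P η Aᶜ ≠ ∞ :=
      ne_top_of_le_ne_top (by rw [hηuniv]; exact hfin.ne) (measure_mono (subset_univ _))
    refine (ENNReal.add_le_add_iff_right hfinc).1 ?_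
    calc palmMeasure θ P η A + palmMeasure θ P η Aᶜ = palmShift θ P ξ η univ := by
          rw [measure_add_measure_compl hA, hηuniv, hsum]
      _ ≤ palmShift θ P ξ η A + palmShift θ P ξ η Aᶜ := h.palmShift_univ_le hθ hP hA
      _ ≤ palmShift θ P ξ η A + palmMeasure θ P η Aᶜ := by
          gcongr; exact h.palmShift_le hθ hP hA.compl
  -- Here the order is reversed: equality holds pathwise, and the absence of lost mass follows from
  -- the equal finite intensities.
  · have hQη : ∀ A, MeasurableSet A → palmShift θ P ξ η A = palmMeasure θ P η A := by
      intro A hA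
      rw [palmShift, h.lintegral_palm_shiftEvent hθ hP hA,
        palmMeasure_eq_Ico h.right_fin hθ hP h.right_cov hA]
      refine lintegral_congr_ae ?_
      filter_upwards [hgood, measure_eq_zero_iff_ae_notMem.1 h0] with ω h1 h2
      have := h.left_fin ω
      have := h.right_fin ω
      have h2 : ¬ ¬ unmatched (ξ ω) (η ω) univ ≠ 0 := h2
      rw [hitMeasure_eq_of_unmatched (h.sing ω) (h.measurable_section ω) (h1 (not_not.1 h2))]
    refine ⟨?_, hQη⟩
    rw [hQη univ MeasurableSet.univ, hηuniv] at hsum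
    exact (ENNReal.add_right_inj hfin.ne).1 (hsum.trans (add_zero _).symm)

end IsCovariantPair

end

/-! ### Removing the exceptional sets. -/

/-- A kernel of locally finite measures on the line is s-finite. -/
theorem isSFiniteKernel_of_isLocallyFinite {Ω : Type*} [MeasurableSpace Ω] (κ : Kernel Ω ℝ)
    (hκ : ∀ ω, IsLocallyFiniteMeasure (κ ω)) : IsSFiniteKernel κ := by
  classical
  -- A finite kernel needs a bound uniform in `ω`, so each block is cut further by the integer part
  -- of its mass.
  let S : ℤ → ℕ → Set Ω := fun n m => {ω | (m : ℝ≥0∞) ≤ κ ω (Ico (n : ℝ) (n + 1)) ∧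
    κ ω (Ico (n : ℝ) (n + 1)) < m + 1}
  have hS : ∀ n m, MeasurableSet (S n m) := fun n m =>
    (measurableSet_le measurable_const (κ.measurable_coe measurableSet_Ico)).inter
      (measurableSet_lt (κ.measurable_coe measurableSet_Ico) measurable_const)
  let K : ℤ × ℕ → Kernel Ω ℝ := fun i => Kernel.piecewise (hS i.1 i.2)
    (κ.restrict (measurableSet_Ico (a := (i.1 : ℝ)) (b := i.1 + 1))) 0
  have hK : ∀ i, IsFiniteKernel (K i) := by
    intro i
    refine ⟨⟨(i.2 : ℝ≥0∞) + 1, by finiteness, fun ω => ?_⟩⟩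
    by_cases h : ω ∈ S i.1 i.2
    · simp only [K, Kernel.piecewise_apply, h, if_true, Kernel.restrict_apply,
        Measure.restrict_apply MeasurableSet.univ, univ_inter]
      exact h.2.le
    · simp [K, Kernel.piecewise_apply, h]
  have hsum : κ = Kernel.sum K := by
    ext ω B hB
    have hfin := hκ ω
    rw [Kernel.sum_apply' _ _ hB, ENNReal.tsum_prod' (f := fun i : ℤ × ℕ => K i ω B)]
    have hinner : ∀ n : ℤ, ∑' m : ℕ, K (n, m) ω B = κ ω (B ∩ Ico (n : ℝ) (n + 1)) := by
      intro n
      have hx : κ ω (Ico (n : ℝ) (n + 1)) ≠ ∞ := measure_Ico_lt_top.ne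
      set x := κ ω (Ico (n : ℝ) (n + 1)) with hxdef
      have hmem : ∀ m : ℕ, ω ∈ S n m ↔ m = ⌊x.toReal⌋₊ := by
        intro m
        rw [eq_comm, Nat.floor_eq_iff ENNReal.toReal_nonneg]
        change ((m : ℝ≥0∞) ≤ x ∧ x < m + 1) ↔ _
        rw [← ENNReal.toReal_le_toReal (by finiteness) hx,
          ← ENNReal.toReal_lt_toReal hx (by finiteness)]
        simp [ENNReal.toReal_add]
      rw [tsum_eq_single ⌊x.toReal⌋₊]
      · simp only [K, Kernel.piecewise_apply, (hmem _).2 rfl, if_true, Kernel.restrict_apply,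
          Measure.restrict_apply hB]
      · intro m hm
        simp [K, Kernel.piecewise_apply, mt (hmem m).1 hm]
    simp only [hinner]
    rw [← measure_iUnion _ fun n => hB.inter measurableSet_Ico, ← inter_iUnion]
    · congr 1
      have hU : (⋃ j : ℤ, Ico (j : ℝ) (j + 1)) = univ := by
        ext x
        simp only [mem_iUnion, mem_univ, iff_true]
        exact ⟨⌊x⌋, Int.floor_le x, Int.lt_floor_add_one x⟩
      rw [hU, inter_univ]
    · intro k l hkl
      rw [Function.onFun, Set.disjoint_left]
      intro x h1 h2
      exact hkl ((Int.floor_eq_iff.2 h1.2).symm.trans (Int.floor_eq_iff.2 h2.2))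
  rw [hsum]
  infer_instance

section
variable {Ω : Type*} [MeasurableSpace Ω] {θ : ℝ → Ω → Ω} {P : Measure Ω}

/-- A flow-invariant property that holds almost everywhere holds on a measurable, strictly invariant
set of full measure. -/
theorem exists_invariant_set (hθ : IsMeasurableFlow θ) (hP : IsStationaryMeasure θ P)
    [SFinite P] {p : Ω → Prop} (hp : ∀ᵐ ω ∂P, p ω) (hinv : ∀ t ω, p ω → p (θ t ω)) :
    ∃ G : Set Ω, MeasurableSet G ∧ (∀ᵐ ω ∂P, ω ∈ G) ∧ (∀ t ω, θ t ω ∈ G ↔ ω ∈ G) ∧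
      ∀ ω ∈ G, p ω := by
  set N := toMeasurable P {ω | ¬ p ω} with hN
  have hNm : MeasurableSet N := measurableSet_toMeasurable _ _
  have hN0 : P N = 0 := by rw [hN, measure_toMeasurable]; exact hp
  have hNp : ∀ ω, ω ∉ N → p ω := fun ω h => by
    by_contra hn
    exact h (subset_toMeasurable P _ hn)
  have hE : MeasurableSet {q : Ω × ℝ | θ q.2 q.1 ∈ N} := hθ.measurable hNm
  -- The points whose orbit spends Lebesgue-null time in `N`. Fubini and stationarity give full
  -- measure, translation invariance of Lebesgue measure gives strict invariance, and one orbit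
  -- point outside `N` carries `p` back along the flow.
  refine ⟨{ω | volume {t : ℝ | θ t ω ∈ N} = 0}, ?_, ?_, ?_, ?_⟩
  · exact (measurable_measure_prodMk_left hE : Measurable fun ω => volume {t : ℝ | θ t ω ∈ N})
      (measurableSet_singleton 0)
  · have h0 : (P.prod volume) {q : Ω × ℝ | θ q.2 q.1 ∈ N} = 0 := by
      rw [Measure.prod_apply_symm hE]
      refine (lintegral_congr fun t => ?_).trans lintegral_zero
      exact ((hP.measurePreserving hθ t).measure_preimage hNm.nullMeasurableSet).trans hN0
    exact (Measure.measure_prod_null hE).1 h0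
  · intro t ω
    have : {r : ℝ | θ r (θ t ω) ∈ N} = (· + t) ⁻¹' {r : ℝ | θ r ω ∈ N} := by
      ext r; simp [hθ.add]
    change volume {r : ℝ | θ r (θ t ω) ∈ N} = 0 ↔ volume {r : ℝ | θ r ω ∈ N} = 0
    rw [this, measure_preimage_add_right]
  · intro ω hω
    have hω : ∀ᵐ t : ℝ, θ t ω ∉ N := measure_eq_zero_iff_ae_notMem.1 hω
    obtain ⟨t, ht⟩ := hω.exists
    have := hinv (-t) _ (hNp _ ht)
    rwa [hθ.add, neg_add_cancel, hθ.zero] at this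

/-- A Palm measure need not be absolutely continuous with respect to `P`; it inherits full-measure
events that are invariant, because they contain whole orbits. -/
theorem ae_palm_of_invariant {ξ : Kernel Ω ℝ} [IsSFiniteKernel ξ]
    (hξfin : ∀ ω, IsLocallyFiniteMeasure (ξ ω)) (hθ : IsMeasurableFlow θ)
    (hP : IsStationaryMeasure θ P) [SFinite P] (hξ : IsCovariant θ ξ) {G : Set Ω}
    (hG : MeasurableSet G) (hGae : ∀ᵐ ω ∂P, ω ∈ G) (hGinv : ∀ t ω, θ t ω ∈ G ↔ ω ∈ G) :
    ∀ᵐ ω ∂(palmMeasure θ P ξ), ω ∈ G := by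
  change palmMeasure θ P ξ Gᶜ = 0
  rw [palmMeasure_eq_Ico hξfin hθ hP hξ hG.compl]
  refine (lintegral_congr_ae ?_).trans lintegral_zero
  filter_upwards [hGae] with ω hω
  convert measure_empty (μ := ξ ω)
  ext s
  simp only [mem_ofPred_eq, mem_empty_iff_false, iff_false]
  exact fun hs => hs.2 ((hGinv s ω).2 hω)

theorem map_sub_eq_of_invariant {ξ : Kernel Ω ℝ} {ω : Ω}
    (h : ∀ (t : ℝ) (C : Set ℝ), MeasurableSet C → ξ (θ t ω) {x | x + t ∈ C} = ξ ω C) (t : ℝ) :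
    ξ (θ t ω) = (ξ ω).map (· - t) := by
  have hm : Measurable fun x : ℝ => x - t := by fun_prop
  ext C hC
  rw [Measure.map_apply hm hC, ← h t _ (hm hC)]
  congr 1
  ext x
  simp

theorem invariant_flow {ξ : Kernel Ω ℝ} {ω : Ω} (hθ : IsMeasurableFlow θ)
    (h : ∀ (t : ℝ) (C : Set ℝ), MeasurableSet C → ξ (θ t ω) {x | x + t ∈ C} = ξ ω C) (r : ℝ) :
    ∀ (t : ℝ) (C : Set ℝ), MeasurableSet C →
      ξ (θ t (θ r ω)) {x | x + t ∈ C} = ξ (θ r ω) C := by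
  intro t C hC
  have hm : ∀ t, Measurable fun x : ℝ => x - t := fun t => by fun_prop
  have hm' : Measurable fun x : ℝ => x + t := by fun_prop
  have hC' : MeasurableSet {x | x + t ∈ C} := hm' hC
  rw [hθ.add, map_sub_eq_of_invariant h, map_sub_eq_of_invariant h, Measure.map_apply (hm _) hC,
    Measure.map_apply (hm _) hC']
  congr 1
  ext x
  simp only [mem_preimage, mem_ofPred_eq]
  rw [show x - (t + r) + t = x - r by ring]

theorem mutuallySingular_map_sub {μ ν : Measure ℝ} (h : μ.MutuallySingular ν) (t : ℝ) :
    (μ.map (· - t)).MutuallySingular (ν.map (· - t)) := by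
  have hm : Measurable fun x : ℝ => x - t := by fun_prop
  have hm' : Measurable fun x : ℝ => x + t := by fun_prop
  refine ⟨(· + t) ⁻¹' h.nullSet, hm' h.measurableSet_nullSet, ?_, ?_⟩
  · rw [Measure.map_apply hm (hm' h.measurableSet_nullSet), ← preimage_comp]
    simp [Function.comp_def]
  · rw [Measure.map_apply hm (hm' h.measurableSet_nullSet).compl, ← preimage_compl,
      ← preimage_comp]
    simp [Function.comp_def]

theorem isCompact_finite_map_sub {μ : Measure ℝ} (h : ∀ C : Set ℝ, IsCompact C → μ C < ∞) (t : ℝ) :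
    ∀ C : Set ℝ, IsCompact C → μ.map (· - t) C < ∞ := by
  intro C hC
  have hm : Measurable fun x : ℝ => x - t := by fun_prop
  rw [Measure.map_apply hm hC.measurableSet]
  have : (fun x : ℝ => x - t) ⁻¹' C = (· + t) '' C := by
    ext x
    constructor
    · exact fun hx => ⟨x - t, hx, by simp⟩
    · rintro ⟨y, hy, rfl⟩; simpa using hy
  rw [this]
  exact h _ (hC.image (by fun_prop))

/-- Random measures that are invariant, locally finite and mutually singular almost everywhere can
be modified on an invariant null set to have these properties everywhere. -/
theorem exists_isCovariantPair [SFinite P] (hθ : IsMeasurableFlow θ)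
    (hP : IsStationaryMeasure θ P) {ξ η : Kernel Ω ℝ}
    (hξ : IsRandomMeasure P ξ) (hη : IsRandomMeasure P η)
    (hξinv : IsInvariantKernel θ P ξ) (hηinv : IsInvariantKernel θ P η)
    (hsing : ∀ᵐ ω ∂P, (ξ ω).MutuallySingular (η ω)) :
    ∃ (ξ' η' : Kernel Ω ℝ) (G : Set Ω), IsCovariantPair θ ξ' η' ∧ MeasurableSet G ∧
      (∀ᵐ ω ∂P, ω ∈ G) ∧ (∀ t ω, θ t ω ∈ G ↔ ω ∈ G) ∧
      ∀ ω ∈ G, ξ' ω = ξ ω ∧ η' ω = η ω := by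
  classical
  let p : Ω → Prop := fun ω =>
    ((∀ C : Set ℝ, IsCompact C → ξ ω C < ∞) ∧ (∀ C : Set ℝ, IsCompact C → η ω C < ∞)) ∧
    ((∀ (t : ℝ) (C : Set ℝ), MeasurableSet C → ξ (θ t ω) {x | x + t ∈ C} = ξ ω C) ∧
    (∀ (t : ℝ) (C : Set ℝ), MeasurableSet C → η (θ t ω) {x | x + t ∈ C} = η ω C)) ∧
    (ξ ω).MutuallySingular (η ω)
  have hp : ∀ᵐ ω ∂P, p ω := by
    filter_upwards [hξ, hη, hξinv, hηinv, hsing] with ω h1 h2 h3 h4 h5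
    exact ⟨⟨h1, h2⟩, ⟨h3, h4⟩, h5⟩
  have hpinv : ∀ t ω, p ω → p (θ t ω) := by
    rintro t ω ⟨⟨h1, h2⟩, ⟨h3, h4⟩, h5⟩
    refine ⟨⟨?_, ?_⟩, ⟨invariant_flow hθ h3 t, invariant_flow hθ h4 t⟩, ?_⟩
    · rw [map_sub_eq_of_invariant h3]; exact isCompact_finite_map_sub h1 t
    · rw [map_sub_eq_of_invariant h4]; exact isCompact_finite_map_sub h2 t
    · rw [map_sub_eq_of_invariant h3, map_sub_eq_of_invariant h4]
      exact mutuallySingular_map_sub h5 t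
  obtain ⟨G, hGm, hGae, hGinv, hGp⟩ := exists_invariant_set hθ hP hp hpinv
  have hval : ∀ (κ : Kernel Ω ℝ), ∀ ω ∈ G, Kernel.piecewise hGm κ 0 ω = κ ω := fun κ ω h => by
    rw [Kernel.piecewise_apply, if_pos h]
  have hzero : ∀ (κ : Kernel Ω ℝ), ∀ ω ∉ G, Kernel.piecewise hGm κ 0 ω = 0 := fun κ ω h => by
    rw [Kernel.piecewise_apply, if_neg h]; rfl
  have hcov : ∀ κ : Kernel Ω ℝ, (∀ ω ∈ G, ∀ (t : ℝ) (C : Set ℝ), MeasurableSet C →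
      κ (θ t ω) {x | x + t ∈ C} = κ ω C) → IsCovariant θ (Kernel.piecewise hGm κ 0) := by
    intro κ h t ω
    by_cases hω : ω ∈ G
    · rw [hval κ ω hω, hval κ _ ((hGinv t ω).2 hω), map_sub_eq_of_invariant (h ω hω)]
    · rw [hzero κ ω hω, hzero κ _ (mt (hGinv t ω).1 hω), Measure.map_zero]
  have hfin : ∀ κ : Kernel Ω ℝ, (∀ ω ∈ G, ∀ C : Set ℝ, IsCompact C → κ ω C < ∞) →
      ∀ ω, IsLocallyFiniteMeasure (Kernel.piecewise hGm κ 0 ω) := by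
    intro κ h ω
    by_cases hω : ω ∈ G
    · rw [hval κ ω hω]
      exact ⟨fun x => ⟨Icc (x - 1) (x + 1), Icc_mem_nhds (by linarith) (by linarith),
        h ω hω _ isCompact_Icc⟩⟩
    · rw [hzero κ ω hω]; infer_instance
  refine ⟨Kernel.piecewise hGm ξ 0, Kernel.piecewise hGm η 0, G, ?_, hGm, hGae, hGinv,
    fun ω hω => ⟨hval ξ ω hω, hval η ω hω⟩⟩
  refine ⟨hcov ξ fun ω hω => (hGp ω hω).2.1.1, hcov η fun ω hω => (hGp ω hω).2.1.2,
    hfin ξ fun ω hω => (hGp ω hω).1.1, hfin η fun ω hω => (hGp ω hω).1.2, fun ω => ?_⟩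
  by_cases hω : ω ∈ G
  · rw [hval ξ ω hω, hval η ω hω]; exact (hGp ω hω).2.2
  · rw [hzero ξ ω hω]; exact Measure.MutuallySingular.zero_left

/-- For measures without atoms the randomization is irrelevant. -/
theorem alloc_eq_allocU {ξ η : Kernel Ω ℝ} {ω : Ω} (h : ∀ s, ξ ω {s} = 0) (u s : ℝ) :
    alloc ξ η ω s = allocU ξ η u ω s := by
  have hna : NullSingletonClass (ξ ω) := ⟨h⟩
  simp only [alloc, allocU, h, mul_zero, zero_add]
  congr! 6
  exact (measure_congr (Ioo_ae_eq_Icc (μ := ξ ω))).symm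

end

/-! ### Transfer to the original kernels and the diffuse case. -/

theorem proposition4p1 {Ω : Type*} [MeasurableSpace Ω] (P : Measure Ω) [SigmaFinite P]
    (θ : ℝ → Ω → Ω) (hθ : IsMeasurableFlow θ) (hstat : IsStationaryMeasure θ P)
    (herg : IsErgodicFlow θ P) (ξ η : Kernel Ω ℝ)
    (hξ : IsRandomMeasure P ξ) (hη : IsRandomMeasure P η)
    (hξinv : IsInvariantKernel θ P ξ) (hηinv : IsInvariantKernel θ P η)
    (hsing : ∀ᵐ ω ∂P, (ξ ω).MutuallySingular (η ω))
    (hint : intensity P ξ = intensity P η) (hfin : intensity P ξ < ∞)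
    -- recurrence; automatic whenever `P` is finite, and implied by conservativity of the flow
    (htot : ∀ᵐ ω ∂P, ξ ω univ = 0 ∨ ξ ω univ = ∞) :
    ((∀ᵐ u ∂(volume.restrict (Icc (0 : ℝ) 1)),
        ∀ᵐ ω ∂(palmMeasure θ P ξ), allocU ξ η u ω 0 ≠ ⊤) ∧
      ∀ A : Set Ω, MeasurableSet A →
        ∫⁻ u in Icc (0 : ℝ) 1,
          palmMeasure θ P ξ (shiftEvent θ (fun ω => allocU ξ η u ω 0) A) = palmMeasure θ P η A) ∧
    ((∀ᵐ ω ∂P, ∀ s : ℝ, ξ ω {s} = 0) →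
      (∀ᵐ ω ∂(palmMeasure θ P ξ), alloc ξ η ω 0 ≠ ⊤) ∧
      ∀ A : Set Ω, MeasurableSet A →
        palmMeasure θ P ξ (shiftEvent θ (fun ω => alloc ξ η ω 0) A) = palmMeasure θ P η A) := by
  obtain ⟨ξ', η', G, hpair, hGm, hGae, hGinv, hG⟩ :=
    exists_isCovariantPair hθ hstat hξ hη hξinv hηinv hsing
  have := isSFiniteKernel_of_isLocallyFinite ξ' hpair.left_fin
  have := isSFiniteKernel_of_isLocallyFinite η' hpair.right_fin
  have hpalmξ : palmMeasure θ P ξ = palmMeasure θ P ξ' := Measure.bind_congr_right (by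
    filter_upwards [hGae] with ω hω
    rw [(hG ω hω).1])
  have hpalmη : palmMeasure θ P η = palmMeasure θ P η' := Measure.bind_congr_right (by
    filter_upwards [hGae] with ω hω
    rw [(hG ω hω).2])
  have hintξ : intensity P ξ' = intensity P ξ := lintegral_congr_ae (by
    filter_upwards [hGae] with ω hω
    rw [(hG ω hω).1])
  have hintη : intensity P η' = intensity P η := lintegral_congr_ae (by
    filter_upwards [hGae] with ω hω
    rw [(hG ω hω).2])
  have htot' : ∀ᵐ ω ∂P, ξ' ω univ = 0 ∨ ξ' ω univ = ∞ := by
    filter_upwards [hGae, htot] with ω hω h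
    rwa [(hG ω hω).1]
  obtain ⟨htop, hbal⟩ := hpair.palm_balance hθ hstat herg (by rw [hintξ, hintη, hint])
    (by rwa [hintξ]) htot'
  have hGpalm := ae_palm_of_invariant hpair.left_fin hθ hstat hpair.left_cov hGm hGae hGinv
  have hU : ∀ u : ℝ, ∀ ω ∈ G, allocU ξ η u ω 0 = hit (ξ' ω) (η' ω) u 0 := fun u ω hω => by
    rw [(hG ω hω).1, (hG ω hω).2]; rfl
  have hfirst : (∀ᵐ u ∂unif, ∀ᵐ ω ∂(palmMeasure θ P ξ), allocU ξ η u ω 0 ≠ ⊤) ∧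
      ∀ A : Set Ω, MeasurableSet A →
        ∫⁻ u, palmMeasure θ P ξ (shiftEvent θ (fun ω => allocU ξ η u ω 0) A) ∂unif =
          palmMeasure θ P η A := by
    rw [hpalmξ, hpalmη]
    constructor
    · filter_upwards [htop] with u hu
      filter_upwards [hGpalm, measure_eq_zero_iff_ae_notMem.1 hu] with ω hω h1
      rw [hU u ω hω]; exact h1
    · intro A hA
      rw [← hbal A hA, palmShift]
      refine lintegral_congr fun u => measure_congr ?_
      filter_upwards [hGpalm] with ω hω
      refine propext (exists_congr fun t => and_congr_left fun _ => ?_)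
      simp only [hU u ω hω]
  refine ⟨hfirst, fun hdiff => ?_⟩
  have hdiff' : ∀ᵐ ω ∂P, ∀ s : ℝ, ξ' ω {s} = 0 := by
    filter_upwards [hGae, hdiff] with ω hω h
    rwa [(hG ω hω).1]
  obtain ⟨D, hDm, hDae, hDinv, hD⟩ := exists_invariant_set hθ hstat hdiff' (fun t ω h s => by
    rw [hpair.left_cov, Measure.map_apply (by fun_prop) (measurableSet_singleton s)]
    convert h (s + t) using 2
    ext x
    simp [sub_eq_iff_eq_add])
  have hDpalm := ae_palm_of_invariant hpair.left_fin hθ hstat hpair.left_cov hDm hDae hDinv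
  rw [← hpalmξ] at hGpalm hDpalm
  -- Without atoms the time does not depend on `u`: one good `u` yields finiteness, and the average
  -- over `u` is that of a constant.
  have halloc : ∀ u : ℝ, ∀ᵐ ω ∂(palmMeasure θ P ξ), alloc ξ η ω 0 = allocU ξ η u ω 0 := by
    intro u
    filter_upwards [hGpalm, hDpalm] with ω h1 h2
    refine alloc_eq_allocU (fun s => ?_) u 0
    rw [← (hG ω h1).1]; exact hD ω h2 s
  constructor
  · obtain ⟨u, hu⟩ := hfirst.1.exists
    filter_upwards [hu, halloc u] with ω h1 h2
    rwa [h2]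
  · intro A hA
    rw [← hfirst.2 A hA]
    have : ∀ u : ℝ, palmMeasure θ P ξ (shiftEvent θ (fun ω => allocU ξ η u ω 0) A) =
        palmMeasure θ P ξ (shiftEvent θ (fun ω => alloc ξ η ω 0) A) := by
      intro u
      refine measure_congr ?_
      filter_upwards [halloc u] with ω h1
      refine propext (exists_congr fun t => and_congr_left fun _ => ?_)
      simp only [h1]
    simp only [this, lintegral_const, measure_univ, mul_one]
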